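/- Let $(V,M_V)$ be a discrete valuation ring with normalized valuation $\mathbf v$, and let $(R,M_R)$ be a Noetherian local subring of $V$ such that $R$ and $V$ have the same quotient field $K$, $V$ is the integral closure of $R$, the conductor $(R:V)=\{x\in K\mid xV\subseteq R\}$ is nonzero, and the inclusion $R\hookrightarrow V$ induces an isomorphism of residue fields $R/M_R\to V/M_V$. Call $R$ a Kunz domain if the numerical semigroup $\mathbf v(R)=\{\mathbf v(r)\mid r\in R\setminus\{0\}\}$ is pseudo-symmetric, i.e., $g:=\sup(\mathbb Z\setminus \mathbf v(R))$ is even and, for every $a\in\mathbb N$ with $a\neq g/2$, either $a\in \mathbf v(R)$ or $g-a\in \mathbf v(R)$. Let $\mathcal F(R)$ be the set of fractional ideals of $R$ (the $R$-submodules $I$ of $K$ such that $xI\subseteq R$ for some $x\in K\setminus\{0\}$). A star operation on $R$ is a map $\star:\mathcal F(R)\to\mathcal F(R)$, $I\mapsto I^\star$, such that, for all $I,J\in\mathcal F(R)$ and $x\in K$: $I\subseteq I^\star$; $I\subseteq J$ implies $I^\star\subseteq J^\star$; $(I^\star)^\star=I^\star$; $x\cdot I^\star=(xI)^\star$; and $R^\star=R$.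 Let $\mathrm{Star}(R)$ be the set of star operations on $R$. **Proposition.** Let $R$ be a Kunz domain such that $\mathbf v(R)=\langle 4,5,7\rangle=\{4a+5b+7c\mid a,b,c\in\mathbb N\}$, and suppose that the residue field of $R$ has finite cardinality $q$. Then $\mathrm{Star}(R)$ is finite and $$|\mathrm{Star}(R)|=2^{2q}+3.$$ -/

import Mathlib

open scoped nonZeroDivisors

/-- A star operation on a domain `D` with quotient field `K`. Mathlib's `FractionalIdeal D⁰ K` is the
type of all `D`-submodules `I` of `K` with `d I ⊆ D` for some `d ≠ 0` (the zero module included), and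
`FractionalIdeal.spanSingleton D⁰ x * I` is the fractional ideal `x I`. -/
@[ext]
structure StarOperation (D K : Type*) [CommRing D] [IsDomain D] [Field K] [Algebra D K]
    [IsFractionRing D K] where
  /-- The map `I ↦ I^⋆`. -/
  star : FractionalIdeal D⁰ K → FractionalIdeal D⁰ K
  le_star : ∀ I, I ≤ star I
  star_mono : ∀ I J, I ≤ J → star I ≤ star J
  star_star : ∀ I, star (star I) = star I
  smul_star : ∀ (x : K) (I), FractionalIdeal.spanSingleton D⁰ x * star I =
    star (FractionalIdeal.spanSingleton D⁰ x * I)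
  star_one : star 1 = 1

/-- `g(S) = sup (ℤ \ S)`. -/
noncomputable def frobeniusNum (S : AddSubmonoid ℕ) : ℤ :=
  sSup {z : ℤ | ¬ ∃ s ∈ S, (s : ℤ) = z}

/-- A numerical semigroup `S` is pseudo-symmetric if `g = g(S)` is even and, for every `a ∈ ℕ` with
`a ≠ g / 2`, either `a ∈ S` or `g - a ∈ S`. -/
structure IsPseudoSymmetric (S : AddSubmonoid ℕ) : Prop where
  finite_compl : ((S : Set ℕ)ᶜ).Finite
  even : Even (frobeniusNum S)
  mem_or_mem : ∀ a : ℕ, 2 * (a : ℤ) ≠ frobeniusNum S →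
    a ∈ S ∨ ∃ s ∈ S, (s : ℤ) = frobeniusNum S - a

/-- The set of values `v(r)`, `r ∈ R \ {0}`, where `v` is the normalized valuation of the discrete
valuation ring `V ⊇ R`. (The value `v(0) = ∞` is not a natural number.) -/
noncomputable def valueSemigroup (R V : Type*) [CommRing R] [CommRing V] [IsDomain V]
    [IsDiscreteValuationRing V] [Algebra R V] : AddSubmonoid ℕ where
  carrier := {n | ∃ r : R, IsDiscreteValuationRing.addVal V (algebraMap R V r) = (n : ℕ∞)}
  zero_mem' := ⟨1, by simp⟩
  add_mem' := by
    rintro m n ⟨r, hr⟩ ⟨s, hs⟩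
    exact ⟨r * s, by rw [map_mul, IsDiscreteValuationRing.addVal_mul, hr, hs]; push_cast; rfl⟩

/-- `R` is a Kunz domain with associated discrete valuation ring `V` and quotient field `K`. -/
structure IsKunzDomain (R V K : Type*) [CommRing R] [IsDomain R] [IsLocalRing R]
    [CommRing V] [IsDomain V] [IsDiscreteValuationRing V] [Field K]
    [Algebra R V] [Algebra R K] [Algebra V K] [IsScalarTower R V K] : Prop where
  /-- `R` is a subring of `V`. -/
  injective : Function.Injective (algebraMap R V)
  /-- `R` and `V` have the same quotient field, namely `K`. -/
  isFractionRing_left : IsFractionRing R K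
  isFractionRing_right : IsFractionRing V K
  /-- `V` is the integral closure of `R` in `K`. -/
  isIntegralClosure : IsIntegralClosure V R K
  isNoetherianRing : IsNoetherianRing R
  /-- The conductor `(R : V) = {x ∈ K | x V ⊆ R}` is nonzero. -/
  conductor_ne_zero : ∃ x : K, x ≠ 0 ∧
    ∀ v : V, ∃ r : R, algebraMap R K r = x * algebraMap V K v
  /-- The inclusion of `R` in `V` induces an isomorphism of residue fields. -/
  isLocalHom : IsLocalHom (algebraMap R V)
  residueField_bijective : Function.Bijective (IsLocalRing.ResidueField.map (algebraMap R V))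
  /-- The value semigroup is pseudo-symmetric. -/
  isPseudoSymmetric : IsPseudoSymmetric (valueSemigroup R V)

/-! Let F n be the set of elements of value at least n, so that F 0 is the valuation ring, and write
I^v = (R : (R : I)). The values of R are 0, 4, 5 and all integers from 7 on; the gaps 1, 2, 3, 6
govern everything.

Every star operation satisfies I ≤ I^⋆ ≤ I^v. If no ideal lies strictly between a nondivisorial I
and I^v, then I^⋆ is I or I^v, so ⋆ amounts to the set of classes (up to multiples) of nondivisorial
ideals that it fixes.

To find these classes, scale I so that R ⊆ I ⊆ F 0. If I has no element of value 6, it is R or a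
multiple of C = R + R t³, the canonical ideal. If it has one, then F 4 ⊆ I. If moreover 3 is a value
of I, then F 3 ⊆ I and I is divisorial. Otherwise I is normal (`IsNormal`), I^v = I + F 3, and I is
classified up to a unit by which of the values 1, 2 it has: both (one class H), only 2 (R + R(t² + a
t³) + F 4), only 1 (R + R(t + a t³) + F 4), or neither (one class L). Each middle type has one class
for every residue class a, that is q of them.

A class y forces a class x when some multiple of y contains x but not x^v, for then x is the
intersection of x^v with that multiple. C forces everything, H everything but C, a middle class
itself and L, and L only itself. The sets closed under forcing are the set of all classes, the
complement of C, the empty set, and L together with any of the 2q middle classes: 2^(2q) + 3 in all.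

The main lemmas are `bijective_closedSets`, `divClosure_eq_or_exists`, `exists_iff_gen` and
`card_closedSets`. -/

open FractionalIdeal

set_option linter.unusedSectionVars false

/-! ### Divisorial closure, and star operations as closed sets of ideal classes. -/

section StarCount

variable {R K : Type*} [CommRing R] [IsDomain R] [Field K] [Algebra R K] [IsFractionRing R K]

/-- The divisorial closure `(R : (R : I))`. -/
noncomputable def divClosure (I : FractionalIdeal R⁰ K) : FractionalIdeal R⁰ K := 1 / (1 / I)

theorem mem_spanSingleton_mul_iff {c : K} (hc : c ≠ 0) {I : FractionalIdeal R⁰ K} {x : K} :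
    x ∈ spanSingleton R⁰ c * I ↔ c⁻¹ * x ∈ I := by
  rw [mem_singleton_mul]
  constructor
  · rintro ⟨y, hy, rfl⟩
    rwa [inv_mul_cancel_left₀ hc]
  · intro h
    exact ⟨_, h, by rw [mul_inv_cancel_left₀ hc]⟩

theorem spanSingleton_inv_mul_cancel {c : K} (hc : c ≠ 0) (I : FractionalIdeal R⁰ K) :
    spanSingleton R⁰ c⁻¹ * (spanSingleton R⁰ c * I) = I := by
  rw [← mul_assoc, spanSingleton_mul_spanSingleton, inv_mul_cancel₀ hc, spanSingleton_one, one_mul]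

theorem spanSingleton_mul_inv_cancel {c : K} (hc : c ≠ 0) (I : FractionalIdeal R⁰ K) :
    spanSingleton R⁰ c * (spanSingleton R⁰ c⁻¹ * I) = I := by
  rw [← mul_assoc, spanSingleton_mul_spanSingleton, mul_inv_cancel₀ hc, spanSingleton_one, one_mul]

theorem spanSingleton_mul_le_iff {c : K} (hc : c ≠ 0) {I J : FractionalIdeal R⁰ K} :
    spanSingleton R⁰ c * I ≤ J ↔ I ≤ spanSingleton R⁰ c⁻¹ * J := by
  constructor
  · intro h
    have := mul_le_mul_right h (spanSingleton R⁰ c⁻¹)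
    rwa [spanSingleton_inv_mul_cancel hc] at this
  · intro h
    have := mul_le_mul_right h (spanSingleton R⁰ c)
    rwa [spanSingleton_mul_inv_cancel hc] at this

theorem spanSingleton_mul_ne_zero {c : K} (hc : c ≠ 0) {I : FractionalIdeal R⁰ K} (hI : I ≠ 0) :
    spanSingleton R⁰ c * I ≠ 0 := fun h => hI <| by
  rw [← spanSingleton_inv_mul_cancel hc I, h, mul_zero]

theorem one_div_ne_zero_of_ne_zero {I : FractionalIdeal R⁰ K} (hI : I ≠ 0) :
    (1 : FractionalIdeal R⁰ K) / I ≠ 0 := by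
  obtain ⟨d, hd, hdI⟩ := I.isFractional
  intro h
  have hm : algebraMap R K d ∈ (1 : FractionalIdeal R⁰ K) / I := by
    rw [mem_div_iff_of_ne_zero hI]
    intro y hy
    obtain ⟨r, hr⟩ := hdI y hy
    rw [mem_one_iff]
    exact ⟨r, by rw [hr, Algebra.smul_def]⟩
  rw [h, mem_zero_iff] at hm
  exact nonZeroDivisors.ne_zero hd ((IsFractionRing.injective R K) (by rw [hm, map_zero]))

theorem mem_divClosure {I : FractionalIdeal R⁰ K} (hI : I ≠ 0) {x : K} :
    x ∈ divClosure I ↔ ∀ z : K, (∀ y ∈ I, z * y ∈ (1 : FractionalIdeal R⁰ K)) →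
      z * x ∈ (1 : FractionalIdeal R⁰ K) := by
  rw [divClosure, mem_div_iff_of_ne_zero (one_div_ne_zero_of_ne_zero hI)]
  simp only [mem_div_iff_of_ne_zero hI]
  constructor
  · intro h z hz
    rw [mul_comm]
    exact h z hz
  · intro h z hz
    rw [mul_comm]
    exact h z hz

@[simp] theorem divClosure_zero : divClosure (0 : FractionalIdeal R⁰ K) = 0 := by
  simp [divClosure]

theorem le_divClosure (I : FractionalIdeal R⁰ K) : I ≤ divClosure I := by
  rcases eq_or_ne I 0 with rfl | hI
  · simp
  · intro x hx
    exact (mem_divClosure hI).2 fun z hz => hz x hx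

theorem divClosure_mono {I J : FractionalIdeal R⁰ K} (h : I ≤ J) :
    divClosure I ≤ divClosure J := by
  rcases eq_or_ne I 0 with rfl | hI
  · simp
  · have hJ : J ≠ 0 := by
      rintro rfl
      exact hI (le_antisymm h (zero_le _))
    intro x hx
    rw [mem_divClosure hJ]
    exact fun z hz => (mem_divClosure hI).1 hx z fun y hy => hz y (h hy)

theorem divClosure_ne_zero {I : FractionalIdeal R⁰ K} (hI : I ≠ 0) : divClosure I ≠ 0 :=
  one_div_ne_zero_of_ne_zero (one_div_ne_zero_of_ne_zero hI)

theorem divClosure_divClosure (I : FractionalIdeal R⁰ K) :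
    divClosure (divClosure I) = divClosure I := by
  rcases eq_or_ne I 0 with rfl | hI
  · simp
  · refine le_antisymm (fun x hx => ?_) (le_divClosure _)
    rw [mem_divClosure hI]
    exact fun z hz => (mem_divClosure (divClosure_ne_zero hI)).1 hx z
      fun y hy => (mem_divClosure hI).1 hy z hz

theorem divClosure_one : divClosure (1 : FractionalIdeal R⁰ K) = 1 := by
  refine le_antisymm (fun x hx => ?_) (le_divClosure _)
  have h1 : (1 : FractionalIdeal R⁰ K) ≠ 0 := fun h => by
    have := one_mem_one (P := K) R⁰
    rw [h, mem_zero_iff] at this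
    exact one_ne_zero this
  simpa using (mem_divClosure h1).1 hx 1 (by simp)

theorem divClosure_smul {c : K} (hc : c ≠ 0) (I : FractionalIdeal R⁰ K) :
    divClosure (spanSingleton R⁰ c * I) = spanSingleton R⁰ c * divClosure I := by
  have key : ∀ {c : K}, c ≠ 0 → ∀ I : FractionalIdeal R⁰ K,
      spanSingleton R⁰ c * divClosure I ≤ divClosure (spanSingleton R⁰ c * I) := by
    intro c hc I
    rcases eq_or_ne I 0 with rfl | hI
    · simp
    have hcI : spanSingleton R⁰ c * I ≠ 0 := spanSingleton_mul_ne_zero hc hI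
    intro x hx
    rw [mem_spanSingleton_mul_iff hc, mem_divClosure hI] at hx
    rw [mem_divClosure hcI]
    intro z hz
    have := hx (z * c) fun y hy => by
      rw [mul_assoc]
      exact hz _ (mem_singleton_mul.2 ⟨y, hy, rfl⟩)
    rwa [mul_assoc, mul_inv_cancel_left₀ hc] at this
  refine le_antisymm ?_ (key hc I)
  have := key (inv_ne_zero hc) (spanSingleton R⁰ c * I)
  rwa [spanSingleton_inv_mul_cancel hc, spanSingleton_mul_le_iff (inv_ne_zero hc), inv_inv] at this

/-- If z I ⊆ R, then z I^⋆ = (z I)^⋆ ⊆ R^⋆ = R. -/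
theorem StarOperation.star_le_divClosure (s : StarOperation R K) (I : FractionalIdeal R⁰ K) :
    s.star I ≤ divClosure I := by
  rcases eq_or_ne I 0 with rfl | hI
  · have := s.smul_star 0 0
    simp only [spanSingleton_zero, zero_mul] at this
    rw [← this]
    exact zero_le _
  · intro x hx
    rw [mem_divClosure hI]
    intro z hz
    rw [← s.star_one]
    refine s.star_mono (spanSingleton R⁰ z * I) 1 (fun w hw => ?_) ?_
    · obtain ⟨y, hy, rfl⟩ := mem_singleton_mul.1 hw
      exact hz y hy
    · rw [← s.smul_star]
      exact mem_singleton_mul.2 ⟨x, hx, rfl⟩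

variable {X : Type*}

/-- The star operation closing exactly the divisorial ideals and the multiples of the members of a
family indexed by `Δ`. -/
noncomputable def starOfFamily (rep : X → FractionalIdeal R⁰ K) (Δ : Set X)
    (hdown : ∀ I, ∀ y ∈ Δ, ∀ c : K, c ≠ 0 → I ≤ spanSingleton R⁰ c * rep y →
      ¬ divClosure I ≤ spanSingleton R⁰ c * rep y →
      ∃ x ∈ Δ, ∃ d : K, d ≠ 0 ∧ I = spanSingleton R⁰ d * rep x) : StarOperation R K := by
  classical
  let P : FractionalIdeal R⁰ K → Prop :=
    fun I => ∃ x ∈ Δ, ∃ d : K, d ≠ 0 ∧ I = spanSingleton R⁰ d * rep x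
  have hP : ∀ {c : K} {I}, c ≠ 0 → P I → P (spanSingleton R⁰ c * I) := by
    rintro c I hc ⟨x, hx, d, hd, rfl⟩
    exact ⟨x, hx, c * d, mul_ne_zero hc hd, by
      rw [← mul_assoc, spanSingleton_mul_spanSingleton]⟩
  refine
    { star := fun I => if P I then I else divClosure I
      le_star := fun I => ?_
      star_mono := fun I J h => ?_
      star_star := fun I => ?_
      smul_star := fun c I => ?_
      star_one := by simp [divClosure_one] }
  · split_ifs
    · exact le_rfl
    · exact le_divClosure I
  · by_cases hJ : P J
    · by_cases hI : P I
      · simpa [hI, hJ] using h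
      · simp only [hI, hJ, if_true, if_false]
        -- The only critical case for monotonicity: J stays fixed while I grows to its divisorial
        -- closure. `hdown` is the condition that excludes a failure here.
        obtain ⟨y, hy, c, hc, rfl⟩ := hJ
        by_contra hcon
        exact hI (hdown I y hy c hc h hcon)
    · simp only [hJ, if_false]
      split_ifs
      · exact h.trans (le_divClosure J)
      · exact divClosure_mono h
  · by_cases hI : P I
    · simp [hI]
    · simp [hI, divClosure_divClosure]
  · rcases eq_or_ne c 0 with rfl | hc
    · simp
    · by_cases hI : P I
      · simp [hI, hP hc hI]
      · have : ¬ P (spanSingleton R⁰ c * I) := fun h => hI (by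
          simpa only [spanSingleton_inv_mul_cancel hc] using hP (inv_ne_zero hc) h)
        simp [hI, this, divClosure_smul hc]

theorem starOfFamily_star_of_mem (rep : X → FractionalIdeal R⁰ K) (Δ : Set X) (hdown)
    {x : X} (hx : x ∈ Δ) : (starOfFamily rep Δ hdown).star (rep x) = rep x := by
  have : ∃ y ∈ Δ, ∃ d : K, d ≠ 0 ∧ rep x = spanSingleton R⁰ d * rep y :=
    ⟨x, hx, 1, one_ne_zero, by simp⟩
  simp [starOfFamily, this]

theorem starOfFamily_star_of_not (rep : X → FractionalIdeal R⁰ K) (Δ : Set X) (hdown)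
    {I : FractionalIdeal R⁰ K}
    (hI : ¬ ∃ x ∈ Δ, ∃ d : K, d ≠ 0 ∧ I = spanSingleton R⁰ d * rep x) :
    (starOfFamily rep Δ hdown).star I = divClosure I := by
  simp only [starOfFamily]
  rw [if_neg hI]

/-- If every nondivisorial ideal is a multiple of a member of the family `rep`, and each member is
covered by its divisorial closure, then star operations correspond to the sets of indices that are
closed under the relation "`rep x` is the intersection of its divisorial closure with a multiple of
`rep y`". -/
theorem bijective_closedSets (rep : X → FractionalIdeal R⁰ K) (rel : X → X → Prop)
    (hclass : ∀ I : FractionalIdeal R⁰ K, divClosure I = I ∨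
      ∃ x, ∃ c : K, c ≠ 0 ∧ I = spanSingleton R⁰ c * rep x)
    (hne : ∀ x, divClosure (rep x) ≠ rep x)
    (hcov : ∀ x J, rep x ≤ J → J ≤ divClosure (rep x) → J = rep x ∨ J = divClosure (rep x))
    (hrel : ∀ x y, (∃ c : K, c ≠ 0 ∧ rep x ≤ spanSingleton R⁰ c * rep y ∧
      ¬ divClosure (rep x) ≤ spanSingleton R⁰ c * rep y) ↔ rel y x) :
    ∃ f : StarOperation R K → {Δ : Set X // ∀ x y, rel y x → y ∈ Δ → x ∈ Δ},
      Function.Bijective f := by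
  refine ⟨fun s => ⟨{x | s.star (rep x) = rep x}, ?_⟩, ?_, ?_⟩
  · intro x y hxy hy
    obtain ⟨c, hc, hle, hnle⟩ := (hrel x y).2 hxy
    rcases hcov x _ (s.le_star _) (s.star_le_divClosure _) with h | h
    · exact h
    · refine absurd ?_ hnle
      -- If `rep x` were not fixed, its star would be its whole divisorial closure, which
      -- monotonicity would force into the fixed multiple of `rep y`.
      have h1 := s.star_mono _ _ hle
      rw [← s.smul_star, show s.star (rep y) = rep y from hy, h] at h1
      exact h1
  · intro s s' hss
    have hss' : ∀ x, s.star (rep x) = rep x ↔ s'.star (rep x) = rep x := fun x =>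
      Set.ext_iff.1 (congrArg Subtype.val hss) x
    ext1
    funext I
    rcases hclass I with h | ⟨x, c, hc, rfl⟩
    · rw [le_antisymm ((s.star_le_divClosure I).trans h.le) (s.le_star I),
        le_antisymm ((s'.star_le_divClosure I).trans h.le) (s'.le_star I)]
    · rw [← s.smul_star, ← s'.smul_star]
      congr 1
      rcases hcov x _ (s.le_star _) (s.star_le_divClosure _) with h | h
      · rw [h, (hss' x).1 h]
      · rcases hcov x _ (s'.le_star _) (s'.star_le_divClosure _) with h' | h'
        · rw [h', (hss' x).2 h']
        · rw [h, h']
  · rintro ⟨Δ, hΔ⟩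
    have hdown : ∀ I, ∀ y ∈ Δ, ∀ c : K, c ≠ 0 → I ≤ spanSingleton R⁰ c * rep y →
        ¬ divClosure I ≤ spanSingleton R⁰ c * rep y →
        ∃ x ∈ Δ, ∃ d : K, d ≠ 0 ∧ I = spanSingleton R⁰ d * rep x := by
      intro I y hy c hc hle hnle
      rcases hclass I with h | ⟨x, d, hd, rfl⟩
      · exact absurd (h.le.trans hle) hnle
      · refine ⟨x, hΔ x y ((hrel x y).1 ⟨d⁻¹ * c, mul_ne_zero (inv_ne_zero hd) hc, ?_, ?_⟩) hy,
          d, hd, rfl⟩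
        · rw [← spanSingleton_mul_spanSingleton, mul_assoc]
          exact (spanSingleton_mul_le_iff hd).1 hle
        · rw [← spanSingleton_mul_spanSingleton, mul_assoc, ← spanSingleton_mul_le_iff hd]
          rwa [← divClosure_smul hd]
    refine ⟨starOfFamily rep Δ hdown, Subtype.ext (Set.ext fun x => ?_)⟩
    simp only [Set.mem_ofPred_eq]
    constructor
    · intro h
      by_contra hx
      refine hne x ?_
      rw [← starOfFamily_star_of_not rep Δ hdown, h]
      rintro ⟨y, hy, d, hd, he⟩
      -- Equivalent representatives are related, because `rep x` is not divisorial; hence distinct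
      -- labels need not be assumed inequivalent.
      refine hx (hΔ x y ((hrel x y).1 ⟨d, hd, he.le, fun hle => hne x ?_⟩) hy)
      exact le_antisymm (hle.trans he.ge) (le_divClosure _)
    · exact starOfFamily_star_of_mem rep Δ hdown

end StarCount

/-! ### Combinatorics of the forcing relation. -/

/-- Labels of the classes of nondivisorial ideals. -/
inductive IdealClassLabel (Y : Type*)
  | canonical
  | hyperplane
  | middle (a : Y)
  | least

namespace IdealClassLabel

variable {Y : Type*}

/-- `Gen y x` says that class `x` is closed for every star operation closing class `y`. -/
def Gen : IdealClassLabel Y → IdealClassLabel Y → Prop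
  | canonical, _ => True
  | hyperplane, canonical => False
  | hyperplane, _ => True
  | middle _, least => True
  | middle a, middle b => a = b
  | middle _, _ => False
  | least, least => True
  | least, _ => False

/-- Containing `canonical` forces everything, and containing `hyperplane` forces all but
`canonical`. Any other nonempty closed set contains `least` and an arbitrary set of middle labels;
the three nested `Option`s record the three exceptional sets. -/
theorem card_closedSets [Finite Y] :
    Finite {Δ : Set (IdealClassLabel Y) // ∀ x y, Gen y x → y ∈ Δ → x ∈ Δ} ∧
      Nat.card {Δ : Set (IdealClassLabel Y) // ∀ x y, Gen y x → y ∈ Δ → x ∈ Δ} =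
        2 ^ Nat.card Y + 3 := by
  classical
  let f : Option (Option (Option (Set Y))) → Set (IdealClassLabel Y)
    | none => Set.univ
    | some none => {canonical}ᶜ
    | some (some none) => ∅
    | some (some (some s)) => {least} ∪ middle '' s
  have hf : ∀ o, ∀ x y, Gen y x → y ∈ f o → x ∈ f o := by
    rintro (_ | _ | _ | s) x y hxy hy <;> cases x <;> cases y <;>
      simp_all [f, Gen]
  let g : Option (Option (Option (Set Y))) →
      {Δ : Set (IdealClassLabel Y) // ∀ x y, Gen y x → y ∈ Δ → x ∈ Δ} := fun o => ⟨f o, hf o⟩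
  have hg : Function.Bijective g := by
    constructor
    · intro o o' h
      have h' : ∀ x, x ∈ f o ↔ x ∈ f o' := Set.ext_iff.1 (congrArg Subtype.val h)
      have h1 := h' canonical
      have h2 := h' hyperplane
      have h3 := h' least
      have h4 := fun a => h' (middle a)
      clear h h'
      rcases o with (_ | _ | _ | s) <;> rcases o' with (_ | _ | _ | s') <;>
        simp [f] at h1 h2 h3 h4 ⊢
      exact Set.ext h4
    · rintro ⟨Δ, hΔ⟩
      by_cases h1 : canonical ∈ Δ
      · refine ⟨none, Subtype.ext (Set.ext fun x => ?_)⟩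
        simpa [g, f] using hΔ x canonical trivial h1
      by_cases h2 : hyperplane ∈ Δ
      · refine ⟨some none, Subtype.ext (Set.ext fun x => ?_)⟩
        rcases x with _ | _ | a | _
        · simpa [g, f] using h1
        · simpa [g, f] using h2
        · simpa [g, f] using hΔ _ _ (by trivial) h2
        · simpa [g, f] using hΔ _ _ (by trivial) h2
      by_cases h3 : least ∈ Δ
      · refine ⟨some (some (some {a | middle a ∈ Δ})), Subtype.ext (Set.ext fun x => ?_)⟩
        cases x <;> simp [g, f, h1, h2, h3]
      · refine ⟨some (some none), Subtype.ext (Set.ext fun x => ?_)⟩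
        rcases x with _ | _ | a | _
        · simpa [g, f] using h1
        · simpa [g, f] using h2
        · simpa [g, f] using fun h => h3 (hΔ _ _ (by trivial) h)
        · simpa [g, f] using h3
  refine ⟨Finite.of_surjective g hg.2, ?_⟩
  rw [← Nat.card_eq_of_bijective g hg]
  rw [Finite.card_option, Finite.card_option, Finite.card_option]
  have : Fintype Y := Fintype.ofFinite Y
  rw [Nat.card_eq_fintype_card, Fintype.card_set, Nat.card_eq_fintype_card]

end IdealClassLabel

/-! ### Arithmetic of values, divisorial overmodules and normal modules. -/

/-- The filtration of `K` by the powers of the maximal ideal of a valuation overring of `R` with the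
same residue field, when the value semigroup of `R` is `{0, 4, 5, 7, 8, …}`. -/
structure ValueFiltration (R K : Type*) [CommRing R] [IsDomain R] [IsLocalRing R] [Field K]
    [Algebra R K] [IsFractionRing R K] where
  F : ℤ → FractionalIdeal R⁰ K
  anti : ∀ {m n}, m ≤ n → F n ≤ F m
  mul_mem_add : ∀ {m n x y}, x ∈ F m → y ∈ F n → x * y ∈ F (m + n)
  mul_notMem : ∀ {m n x y}, x ∉ F (m + 1) → y ∉ F (n + 1) → x * y ∉ F (m + n + 1)
  exists_exact : ∀ {x}, x ≠ 0 → ∃ n, x ∈ F n ∧ x ∉ F (n + 1)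
  approx : ∀ {n x y}, x ∈ F n → x ∉ F (n + 1) → y ∈ F n →
    ∃ r : R, y - algebraMap R K r * x ∈ F (n + 1)
  t : K
  t_mem : t ∈ F 1
  t_notMem : t ∉ F 2
  one_notMem : 1 ∉ F 1
  one_le : 1 ≤ F 0
  F7_le : F 7 ≤ 1
  mem_four : ∀ {x}, x ∈ (1 : FractionalIdeal R⁰ K) → x ∈ F 1 → x ∈ F 4
  mem_seven : ∀ {x}, x ∈ (1 : FractionalIdeal R⁰ K) → x ∈ F 6 → x ∈ F 7
  x₄ : R
  x₄_mem : algebraMap R K x₄ ∈ F 4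
  x₄_notMem : algebraMap R K x₄ ∉ F 5
  x₅ : R
  x₅_mem : algebraMap R K x₅ ∈ F 5
  x₅_notMem : algebraMap R K x₅ ∉ F 6
  mem_maximal : ∀ r : R, r ∈ IsLocalRing.maximalIdeal R ↔ algebraMap R K r ∈ F 1

namespace ValueFiltration

variable {R K : Type*} [CommRing R] [IsDomain R] [IsLocalRing R] [Field K]
    [Algebra R K] [IsFractionRing R K]

theorem add_mem {I : FractionalIdeal R⁰ K} {x y : K} (hx : x ∈ I) (hy : y ∈ I) : x + y ∈ I :=
  (I : Submodule R K).add_mem hx hy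

theorem sub_mem {I : FractionalIdeal R⁰ K} {x y : K} (hx : x ∈ I) (hy : y ∈ I) : x - y ∈ I :=
  (I : Submodule R K).sub_mem hx hy

theorem neg_mem {I : FractionalIdeal R⁰ K} {x : K} (hx : x ∈ I) : -x ∈ I :=
  (I : Submodule R K).neg_mem hx

theorem smul_mem {I : FractionalIdeal R⁰ K} (r : R) {x : K} (hx : x ∈ I) :
    algebraMap R K r * x ∈ I := by
  rw [← Algebra.smul_def]
  exact (I : Submodule R K).smul_mem r hx

theorem mem_of_sub {I : FractionalIdeal R⁰ K} {x y : K} (h : x - y ∈ I) (hy : y ∈ I) : x ∈ I := by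
  simpa using add_mem h hy

theorem mem_of_one_mem {I : FractionalIdeal R⁰ K} (h1 : (1 : K) ∈ I) (r : R) :
    algebraMap R K r ∈ I := by
  simpa using smul_mem r h1

theorem coe_mem_one (r : R) : algebraMap R K r ∈ (1 : FractionalIdeal R⁰ K) :=
  (mem_one_iff _).2 ⟨r, rfl⟩

theorem one_le_of_one_mem {I : FractionalIdeal R⁰ K} (h1 : (1 : K) ∈ I) : 1 ≤ I := by
  intro x hx
  obtain ⟨r, rfl⟩ := (mem_one_iff _).1 hx
  exact mem_of_one_mem h1 r

variable (φ : ValueFiltration R K)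

/-- `x` has value exactly `n`. -/
def Exact (n : ℤ) (x : K) : Prop := x ∈ φ.F n ∧ x ∉ φ.F (n + 1)

variable {φ}

theorem mul_mem {m n : ℤ} (k : ℤ) {x y : K} (hx : x ∈ φ.F m) (hy : y ∈ φ.F n) (h : k ≤ m + n) :
    x * y ∈ φ.F k :=
  φ.anti h (φ.mul_mem_add hx hy)

theorem Exact.mul {m n : ℤ} (k : ℤ) {x y : K} (hx : φ.Exact m x) (hy : φ.Exact n y)
    (h : k = m + n) : φ.Exact k (x * y) := by
  subst h
  exact ⟨φ.mul_mem_add hx.1 hy.1, φ.mul_notMem hx.2 hy.2⟩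

theorem Exact.ne_zero {n : ℤ} {x : K} (hx : φ.Exact n x) : x ≠ 0 := by
  rintro rfl
  exact hx.2 (zero_mem _)

theorem Exact.unique {m n : ℤ} {x : K} (hx : φ.Exact m x) (hy : φ.Exact n x) : m = n := by
  by_contra hne
  rcases lt_or_gt_of_ne hne with h | h
  · exact hx.2 (φ.anti (by omega) hy.1)
  · exact hy.2 (φ.anti (by omega) hx.1)

theorem exact_one : φ.Exact 0 1 := ⟨φ.one_le (by simp), by simpa using φ.one_notMem⟩

theorem exact_t : φ.Exact 1 φ.t := ⟨φ.t_mem, by simpa using φ.t_notMem⟩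

theorem exact_t_sq : φ.Exact 2 (φ.t ^ 2) := by
  rw [pow_two]
  exact exact_t.mul 2 exact_t (by norm_num)

theorem exact_t_cube : φ.Exact 3 (φ.t ^ 3) := by
  rw [pow_succ]
  exact exact_t_sq.mul 3 exact_t (by norm_num)

theorem exact_x₄ : φ.Exact 4 (algebraMap R K φ.x₄) := ⟨φ.x₄_mem, by simpa using φ.x₄_notMem⟩

theorem exact_x₅ : φ.Exact 5 (algebraMap R K φ.x₅) := ⟨φ.x₅_mem, by simpa using φ.x₅_notMem⟩

theorem Exact.inv {n : ℤ} (k : ℤ) {x : K} (hx : φ.Exact n x) (h : k = -n) : φ.Exact k x⁻¹ := by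
  obtain ⟨m, hm⟩ := φ.exists_exact (inv_ne_zero hx.ne_zero)
  have h1 := hx.mul (n + m) hm rfl
  rw [mul_inv_cancel₀ hx.ne_zero] at h1
  have := h1.unique exact_one
  obtain rfl : k = m := by omega
  exact hm

theorem exists_exact_int (φ : ValueFiltration R K) (n : ℤ) : ∃ x, φ.Exact n x := by
  have hpow : ∀ n : ℕ, φ.Exact n (φ.t ^ n) := by
    intro n
    induction n with
    | zero => simpa using exact_one
    | succ n ih =>
      rw [pow_succ]
      exact ih.mul _ exact_t (by push_cast; rfl)
  obtain ⟨m, rfl | rfl⟩ := n.eq_nat_or_neg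
  · exact ⟨_, hpow m⟩
  · exact ⟨_, (hpow m).inv _ rfl⟩

theorem Exact.mul_mem_iff {n : ℤ} {u x : K} (hu : φ.Exact n u) (m k : ℤ) (h : k = m + n) :
    u * x ∈ φ.F k ↔ x ∈ φ.F m := by
  constructor
  · intro hx
    have := mul_mem m (hu.inv (-n) rfl).1 hx (by omega)
    rwa [inv_mul_cancel_left₀ hu.ne_zero] at this
  · intro hx
    exact mul_mem k hu.1 hx (by omega)

theorem Exact.approx {n : ℤ} {x y : K} (hx : φ.Exact n x) (hy : y ∈ φ.F n) (m : ℤ)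
    (h : m = n + 1) : ∃ r : R, y - algebraMap R K r * x ∈ φ.F m := by
  subst h
  exact φ.approx hx.1 hx.2 hy

theorem exact_of_not {n : ℤ} {x : K} (hx : x ∈ φ.F n) (m : ℤ) (hx' : x ∉ φ.F m) (h : m = n + 1) :
    φ.Exact n x := by
  subst h
  exact ⟨hx, hx'⟩

theorem Exact.notMem {n : ℤ} {x : K} (hx : φ.Exact n x) (m : ℤ) (h : n < m) : x ∉ φ.F m :=
  fun hm => hx.2 (φ.anti (by omega) hm)

/-- For x of value n, F n = R x + F (n + 1), since leading coefficients can be matched by elements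
of R. This lets value sets alone prove inclusions. -/
theorem F_le_of_exact {n : ℤ} {x : K} (hx : φ.Exact n x) {I : FractionalIdeal R⁰ K} (hI : x ∈ I)
    {m : ℤ} (hm : φ.F m ≤ I) (h : m = n + 1) : φ.F n ≤ I := by
  intro y hy
  obtain ⟨r, hr⟩ := hx.approx hy m h
  exact mem_of_sub (hm hr) (smul_mem r hI)

theorem coe_mem_F_zero (φ : ValueFiltration R K) (r : R) : algebraMap R K r ∈ φ.F 0 :=
  φ.one_le (coe_mem_one r)

theorem coe_mem_four {r : R} (h : algebraMap R K r ∈ φ.F 1) : algebraMap R K r ∈ φ.F 4 :=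
  φ.mem_four (coe_mem_one r) h

/-- If `z I ⊆ R` and `I` contains elements of values `0` and `6`, then `z` has value at least `4`. -/
theorem mem_four_of_mul {I : FractionalIdeal R⁰ K} (h1 : (1 : K) ∈ I) {w : K} (n : ℤ)
    (hw : φ.Exact n w) (hn : ∀ x ∈ (1 : FractionalIdeal R⁰ K), ¬ φ.Exact n x)
    (hI : w ∈ I) {z : K} (hz : ∀ y ∈ I, z * y ∈ (1 : FractionalIdeal R⁰ K)) : z ∈ φ.F 4 := by
  have hz1 : z ∈ (1 : FractionalIdeal R⁰ K) := by simpa using hz 1 h1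
  refine φ.mem_four hz1 (by_contra fun h => ?_)
  exact hn _ (hz w hI) ((exact_of_not (φ.one_le hz1) 1 h (by norm_num)).mul n hw (by ring))

theorem one_not_exact_six : ∀ x ∈ (1 : FractionalIdeal R⁰ K), ¬ φ.Exact 6 x :=
  fun _ hx h => h.2 (φ.mem_seven hx h.1)

theorem one_not_exact_three : ∀ x ∈ (1 : FractionalIdeal R⁰ K), ¬ φ.Exact 3 x :=
  fun _ hx h => h.2 (φ.mem_four hx (φ.anti (by norm_num) h.1))

theorem ne_zero_of_one_mem {I : FractionalIdeal R⁰ K} (h1 : (1 : K) ∈ I) : I ≠ 0 := by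
  rintro rfl
  exact one_ne_zero ((mem_zero_iff _).1 h1)

/-- Overmodules of `R` inside the valuation ring containing all elements of value at least `3` are
divisorial. -/
theorem divClosure_eq_of_F3_le {J : FractionalIdeal R⁰ K} (h1 : (1 : K) ∈ J) (h3 : φ.F 3 ≤ J)
    (h0 : J ≤ φ.F 0) : divClosure J = J := by
  refine le_antisymm (fun x hx => ?_) (le_divClosure J)
  rw [mem_divClosure (ne_zero_of_one_mem h1)] at hx
  have hx0 : x ∈ φ.F 0 := by
    by_contra hx0
    have hxne : x ≠ 0 := by
      rintro rfl
      exact hx0 (zero_mem _)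
    obtain ⟨n, hn⟩ := φ.exists_exact hxne
    have hn0 : n < 0 := by
      by_contra h
      exact hx0 (φ.anti (by omega) hn.1)
    -- As n < 0, z has value at least 7, so z J ⊆ F 7 ⊆ R, whereas z x has the gap 6 as its value.
    obtain ⟨z, hz⟩ := φ.exists_exact_int (6 - n)
    refine one_not_exact_six _ (hx z fun y hy => ?_) (hz.mul 6 hn (by ring))
    exact φ.F7_le (mul_mem 7 hz.1 (h0 hy) (by omega))
  obtain ⟨r, hr⟩ := exact_one.approx hx0 1 (by norm_num)
  rw [mul_one] at hr
  refine mem_of_sub ?_ (mem_of_one_mem h1 r)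
  set x' := x - algebraMap R K r with hx'
  replace hx : ∀ z : K, (∀ y ∈ J, z * y ∈ (1 : FractionalIdeal R⁰ K)) →
      z * x' ∈ (1 : FractionalIdeal R⁰ K) := by
    intro z hz
    rw [hx', mul_sub]
    exact sub_mem (hx z hz) (hz _ (mem_of_one_mem h1 r))
  clear_value x'
  clear hx' hx0 x
  -- For each k ∈ {1, 2} that is not a value of J, an element z of value 6 - k with z J ⊆ R prevents
  -- the remaining part of x' from having value k. The element x₅ or x₄ itself serves as z, except
  -- when J has value 1 but not 2.
  by_cases hE1 : ∃ y ∈ J, φ.Exact 1 y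
  · obtain ⟨y, hyJ, hy⟩ := hE1
    obtain ⟨s, hs⟩ := hy.approx hr 2 (by norm_num)
    by_cases hE2 : ∃ y ∈ J, φ.Exact 2 y
    · obtain ⟨y₂, hy₂J, hy₂⟩ := hE2
      exact F_le_of_exact hy hyJ (F_le_of_exact hy₂ hy₂J h3 (by norm_num)) (by norm_num) hr
    · refine mem_of_sub ?_ (smul_mem s hyJ)
      by_cases h' : x' - algebraMap R K s * y ∈ φ.F 3
      · exact h3 h'
      exfalso
      have hxE := exact_of_not hs 3 h' (by norm_num)
      -- x₄ y need not lie in R: modulo F 7 it is a x₅ + b x₅ y, and x₅ y has value 6. Replacing x₄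
      -- by x₄ - b x₅ removes that term and keeps the value 4.
      obtain ⟨a, ha⟩ := exact_x₅.approx (mul_mem 5 exact_x₄.1 hy.1 (by norm_num)) 6 (by norm_num)
      obtain ⟨b, hb⟩ := (exact_x₅.mul 6 hy (by norm_num)).approx ha 7 (by norm_num)
      set z := algebraMap R K φ.x₄ - algebraMap R K b * algebraMap R K φ.x₅ with hzdef
      have hz : φ.Exact 4 z := by
        refine ⟨sub_mem exact_x₄.1 (smul_mem b (φ.anti (by norm_num) exact_x₅.1)), fun h => ?_⟩
        exact exact_x₄.2 (mem_of_sub h (smul_mem b exact_x₅.1))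
      have hzy : z * y ∈ (1 : FractionalIdeal R⁰ K) := by
        refine mem_of_sub (φ.F7_le ?_) (coe_mem_one (a * φ.x₅))
        convert hb using 1
        rw [hzdef, map_mul]
        ring
      have hz1 : z ∈ (1 : FractionalIdeal R⁰ K) := by
        rw [hzdef, ← map_mul, ← map_sub]
        exact coe_mem_one _
      have hzJ : ∀ w ∈ J, z * w ∈ (1 : FractionalIdeal R⁰ K) := by
        intro w hw
        obtain ⟨c, hc⟩ := exact_one.approx (h0 hw) 1 (by norm_num)
        obtain ⟨d, hd⟩ := hy.approx hc 2 (by norm_num)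
        have hdJ : w - algebraMap R K c * 1 - algebraMap R K d * y ∈ J :=
          sub_mem (sub_mem hw (smul_mem c h1)) (smul_mem d hyJ)
        have hd3 : w - algebraMap R K c * 1 - algebraMap R K d * y ∈ φ.F 3 := by
          by_contra h
          exact hE2 ⟨_, hdJ, exact_of_not hd 3 h (by norm_num)⟩
        have := add_mem (add_mem (φ.F7_le (mul_mem 7 hz.1 hd3 (by norm_num))) (smul_mem c hz1))
          (smul_mem d hzy)
        convert this using 1
        ring
      refine one_not_exact_six _ ?_ (hz.mul 6 hxE (by norm_num))
      rw [mul_sub]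
      refine sub_mem (hx z hzJ) ?_
      rw [mul_left_comm]
      exact smul_mem s hzy
  · have hJ2 : ∀ w ∈ J, ∃ c : R, w - algebraMap R K c ∈ φ.F 2 := by
      intro w hw
      obtain ⟨c, hc⟩ := exact_one.approx (h0 hw) 1 (by norm_num)
      rw [mul_one] at hc
      refine ⟨c, by_contra fun h => ?_⟩
      exact hE1 ⟨_, sub_mem hw (mem_of_one_mem h1 c), exact_of_not hc 2 h (by norm_num)⟩
    have hx2 : x' ∈ φ.F 2 := by
      by_contra h
      refine one_not_exact_six _ (hx _ fun w hw => ?_)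
        (exact_x₅.mul 6 (exact_of_not hr 2 h (by norm_num)) (by norm_num))
      obtain ⟨c, hc⟩ := hJ2 w hw
      have := add_mem (φ.F7_le (mul_mem 7 exact_x₅.1 hc (by norm_num))) (coe_mem_one (φ.x₅ * c))
      convert this using 1
      rw [map_mul]
      ring
    by_cases hE2 : ∃ y ∈ J, φ.Exact 2 y
    · obtain ⟨y₂, hy₂J, hy₂⟩ := hE2
      exact F_le_of_exact hy₂ hy₂J h3 (by norm_num) hx2
    · by_cases hx3 : x' ∈ φ.F 3
      · exact h3 hx3
      exfalso
      refine one_not_exact_six _ (hx _ fun w hw => ?_)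
        (exact_x₄.mul 6 (exact_of_not hx2 3 hx3 (by norm_num)) (by norm_num))
      obtain ⟨c, hc⟩ := hJ2 w hw
      have hc3 : w - algebraMap R K c ∈ φ.F 3 := by
        by_contra h
        exact hE2 ⟨_, sub_mem hw (mem_of_one_mem h1 c), exact_of_not hc 3 h (by norm_num)⟩
      have := add_mem (φ.F7_le (mul_mem 7 exact_x₄.1 hc3 (by norm_num))) (coe_mem_one (φ.x₄ * c))
      convert this using 1
      rw [map_mul]
      ring

/-- Overmodules of `R` inside the valuation ring with all values at least `4` but not `3`. -/
structure IsNormal (φ : ValueFiltration R K) (I : FractionalIdeal R⁰ K) : Prop where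
  one_mem : (1 : K) ∈ I
  F4_le : φ.F 4 ≤ I
  le_F0 : I ≤ φ.F 0
  mem_four : ∀ x ∈ I, x ∈ φ.F 3 → x ∈ φ.F 4

theorem IsNormal.not_exact_three {I : FractionalIdeal R⁰ K} (hI : φ.IsNormal I) {x : K}
    (hx : φ.Exact 3 x) : x ∉ I :=
  fun h => hx.2 (hI.mem_four x h hx.1)

/-- If z I ⊆ R then z ∈ R, because 1 ∈ I. Value 0 for z would give R an element of value 6, so z has
value at least 4 and z F 3 ⊆ F 7 ⊆ R. -/
theorem IsNormal.F3_le_divClosure {I : FractionalIdeal R⁰ K} (hI : φ.IsNormal I) :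
    φ.F 3 ≤ divClosure I := by
  intro f hf
  rw [mem_divClosure (ne_zero_of_one_mem hI.one_mem)]
  intro z hz
  obtain ⟨w, hw⟩ := φ.exists_exact_int 6
  have := mem_four_of_mul hI.one_mem 6 hw one_not_exact_six
    (hI.F4_le (φ.anti (by norm_num) hw.1)) hz
  exact φ.F7_le (mul_mem 7 this hf (by norm_num))

/-- The upper bound holds because I ⊔ F 3 is itself divisorial. -/
theorem IsNormal.divClosure_eq {I : FractionalIdeal R⁰ K} (hI : φ.IsNormal I) :
    divClosure I = I ⊔ φ.F 3 := by
  refine le_antisymm ?_ (sup_le (le_divClosure I) hI.F3_le_divClosure)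
  rw [← divClosure_eq_of_F3_le (φ := φ) (J := I ⊔ φ.F 3)]
  · exact divClosure_mono le_sup_left
  · exact (le_sup_left : I ≤ I ⊔ φ.F 3) hI.one_mem
  · exact le_sup_right
  · exact sup_le hI.le_F0 (φ.anti (by norm_num))

theorem IsNormal.divClosure_ne {I : FractionalIdeal R⁰ K} (hI : φ.IsNormal I) :
    divClosure I ≠ I := fun h =>
  hI.not_exact_three exact_t_cube (h ▸ hI.F3_le_divClosure exact_t_cube.1)

/-- Modulo I, the closure is spanned by any single element of value 3, and a strictly larger J
contains one. -/
theorem IsNormal.eq_or_eq {I : FractionalIdeal R⁰ K} (hI : φ.IsNormal I)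
    (J : FractionalIdeal R⁰ K) (hIJ : I ≤ J) (hJ : J ≤ divClosure I) :
    J = I ∨ J = divClosure I := by
  by_cases h : J ≤ I
  · exact Or.inl (le_antisymm h hIJ)
  right
  refine le_antisymm hJ ?_
  rw [hI.divClosure_eq] at hJ ⊢
  obtain ⟨j, hj, hjI⟩ := Set.not_subset.1 h
  have hj' := hJ hj
  rw [sup_eq_add, mem_add] at hj'
  obtain ⟨i, hi, f, hf, rfl⟩ := hj'
  have hfJ : f ∈ J := by simpa using sub_mem hj (hIJ hi)
  have hfE : φ.Exact 3 f := exact_of_not hf 4 (fun h4 => hjI (add_mem hi (hI.F4_le h4)))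
    (by norm_num)
  exact sup_le hIJ (F_le_of_exact hfE hfJ (hI.F4_le.trans hIJ) (by norm_num))

end ValueFiltration

/-! ### The canonical ideal, and overmodules without the value 6. -/

namespace ValueFiltration

variable {R K : Type*} [CommRing R] [IsDomain R] [IsLocalRing R] [Field K]
    [Algebra R K] [IsFractionRing R K] {φ : ValueFiltration R K}

/-- Multiples of x₄ and x₅ clear the values 4 and 5; the remainder has value at least 6, hence at
least 7, and F 7 ⊆ R. -/
theorem mem_one_of_mem_F6 {I : FractionalIdeal R⁰ K} (h1 : (1 : K) ∈ I)
    (h6 : ∀ x ∈ I, x ∈ φ.F 6 → x ∈ φ.F 7) {x : K} (hx : x ∈ I) (hx4 : x ∈ φ.F 4) :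
    x ∈ (1 : FractionalIdeal R⁰ K) := by
  obtain ⟨a, ha⟩ := exact_x₄.approx hx4 5 (by norm_num)
  obtain ⟨b, hb⟩ := exact_x₅.approx ha 6 (by norm_num)
  have hb' := h6 _ (sub_mem (sub_mem hx (smul_mem a (mem_of_one_mem h1 _)))
    (smul_mem b (mem_of_one_mem h1 _))) hb
  exact mem_of_sub (mem_of_sub (φ.F7_le hb') (smul_mem b (coe_mem_one _)))
    (smul_mem a (coe_mem_one _))

theorem F4_le_of_exact_six {I : FractionalIdeal R⁰ K} (h1 : (1 : K) ∈ I) {w : K}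
    (hw : φ.Exact 6 w) (hwI : w ∈ I) : φ.F 4 ≤ I :=
  F_le_of_exact exact_x₄ (mem_of_one_mem h1 _)
    (F_le_of_exact exact_x₅ (mem_of_one_mem h1 _)
      (F_le_of_exact hw hwI (φ.F7_le.trans (one_le_of_one_mem h1)) (by norm_num))
      (by norm_num)) (by norm_num)

/-- The canonical ideal `R + R t³`. -/
noncomputable def canonicalIdeal (φ : ValueFiltration R K) : FractionalIdeal R⁰ K :=
  1 ⊔ spanSingleton R⁰ (φ.t ^ 3)

theorem mem_canonicalIdeal {x : K} : x ∈ φ.canonicalIdeal ↔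
    ∃ a b : R, x = algebraMap R K a + algebraMap R K b * φ.t ^ 3 := by
  rw [canonicalIdeal, sup_eq_add, mem_add]
  simp only [mem_one_iff, mem_spanSingleton, Algebra.smul_def]
  constructor
  · rintro ⟨_, ⟨a, rfl⟩, _, ⟨b, rfl⟩, rfl⟩
    exact ⟨a, b, rfl⟩
  · rintro ⟨a, b, rfl⟩
    exact ⟨_, ⟨a, rfl⟩, _, ⟨b, rfl⟩, rfl⟩

theorem one_le_canonicalIdeal : 1 ≤ φ.canonicalIdeal := le_sup_left

theorem one_mem_canonicalIdeal : (1 : K) ∈ φ.canonicalIdeal := one_le_canonicalIdeal (by simp)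

theorem t_cube_mem_canonicalIdeal : φ.t ^ 3 ∈ φ.canonicalIdeal :=
  (le_sup_right : spanSingleton R⁰ (φ.t ^ 3) ≤ φ.canonicalIdeal) (mem_spanSingleton_self R⁰ _)

theorem canonicalIdeal_le : φ.canonicalIdeal ≤ 1 ⊔ φ.F 3 := by
  refine sup_le le_sup_left ?_
  rw [spanSingleton_le_iff_mem]
  exact (le_sup_right : φ.F 3 ≤ 1 ⊔ φ.F 3) exact_t_cube.1

/-- If a + b t³ has value at least 6, then a and b are both nonunits, so b t³ ∈ F 7; this leaves a
with value at least 6, and 6 is a gap of R. -/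
theorem canonicalIdeal_mem_seven {x : K} (hx : x ∈ φ.canonicalIdeal) (h6 : x ∈ φ.F 6) :
    x ∈ φ.F 7 := by
  obtain ⟨a, b, rfl⟩ := mem_canonicalIdeal.1 hx
  have hb : algebraMap R K b * φ.t ^ 3 ∈ φ.F 3 := smul_mem b exact_t_cube.1
  have ha : algebraMap R K a ∈ φ.F 1 := by
    refine φ.anti (by norm_num : (1 : ℤ) ≤ 3) ?_
    simpa using sub_mem (φ.anti (by norm_num) h6) hb
  have hb1 : algebraMap R K b ∈ φ.F 1 := by
    rw [← exact_t_cube.mul_mem_iff 1 4 (by norm_num), mul_comm]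
    simpa using sub_mem (φ.anti (by norm_num) h6) (coe_mem_four ha)
  have h7 : algebraMap R K b * φ.t ^ 3 ∈ φ.F 7 :=
    mul_mem 7 (coe_mem_four hb1) exact_t_cube.1 (by norm_num)
  refine add_mem (φ.mem_seven (coe_mem_one a) ?_) h7
  simpa using sub_mem h6 (φ.anti (by norm_num) h7)

theorem one_sup_F3_divClosure : divClosure (1 ⊔ φ.F 3) = 1 ⊔ φ.F 3 :=
  divClosure_eq_of_F3_le (φ := φ) ((le_sup_left : 1 ≤ 1 ⊔ φ.F 3) (by simp)) le_sup_right
    (sup_le φ.one_le (φ.anti (by norm_num)))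

/-- The gap used here is 3: since t³ lies in the ideal, a z carrying the ideal into R cannot have
value 0, so z F 3 ⊆ F 7. -/
theorem divClosure_canonicalIdeal : divClosure φ.canonicalIdeal = 1 ⊔ φ.F 3 := by
  refine le_antisymm ?_ (sup_le (one_le_canonicalIdeal.trans (le_divClosure _)) ?_)
  · rw [← one_sup_F3_divClosure]
    exact divClosure_mono canonicalIdeal_le
  · intro f hf
    rw [mem_divClosure (ne_zero_of_one_mem one_mem_canonicalIdeal)]
    intro z hz
    have := mem_four_of_mul one_mem_canonicalIdeal 3 exact_t_cube one_not_exact_three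
      t_cube_mem_canonicalIdeal hz
    exact φ.F7_le (mul_mem 7 this hf (by norm_num))

theorem divClosure_canonicalIdeal_ne : divClosure φ.canonicalIdeal ≠ φ.canonicalIdeal := by
  rw [divClosure_canonicalIdeal]
  intro h
  obtain ⟨w, hw⟩ := φ.exists_exact_int 6
  refine hw.2 (canonicalIdeal_mem_seven (h ▸ ?_) hw.1)
  exact (le_sup_right : φ.F 3 ≤ 1 ⊔ φ.F 3) (φ.anti (by norm_num) hw.1)

theorem canonicalIdeal_eq_or_eq (J : FractionalIdeal R⁰ K) (hJ : φ.canonicalIdeal ≤ J)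
    (hJ' : J ≤ divClosure φ.canonicalIdeal) :
    J = φ.canonicalIdeal ∨ J = divClosure φ.canonicalIdeal := by
  rw [divClosure_canonicalIdeal] at *
  have h1 : (1 : K) ∈ J := hJ one_mem_canonicalIdeal
  by_cases h6 : ∃ w ∈ J, φ.Exact 6 w
  · right
    obtain ⟨w, hwJ, hw⟩ := h6
    refine le_antisymm hJ' (sup_le (one_le_of_one_mem h1) ?_)
    exact F_le_of_exact exact_t_cube (hJ t_cube_mem_canonicalIdeal) (F4_le_of_exact_six h1 hw hwJ)
      (by norm_num)
  · left
    refine le_antisymm (fun x hx => ?_) hJ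
    have hx' := hJ' hx
    rw [sup_eq_add, mem_add] at hx'
    obtain ⟨i, hi, f, hf, rfl⟩ := hx'
    have hfJ : f ∈ J := by simpa using sub_mem hx (one_le_of_one_mem h1 hi)
    obtain ⟨b, hb⟩ := exact_t_cube.approx hf 4 (by norm_num)
    have := mem_one_of_mem_F6 (φ := φ) h1 (fun x hx h => by_contra fun h7 =>
      h6 ⟨x, hx, h, by simpa using h7⟩) (sub_mem hfJ (smul_mem b (hJ t_cube_mem_canonicalIdeal))) hb
    exact add_mem (one_le_canonicalIdeal hi) (mem_of_sub (one_le_canonicalIdeal this)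
      (smul_mem b t_cube_mem_canonicalIdeal))

/-- Overmodules of `R` in the valuation ring without elements of value `6` are `R` or multiples of
the canonical ideal. -/
theorem eq_one_or_eq_canonicalIdeal {I : FractionalIdeal R⁰ K} (h1 : (1 : K) ∈ I)
    (h0 : I ≤ φ.F 0) (h6 : ∀ x ∈ I, x ∈ φ.F 6 → x ∈ φ.F 7) :
    I = 1 ∨ ∃ u, u ≠ 0 ∧ I = spanSingleton R⁰ u * φ.canonicalIdeal := by
  have hne : ∀ x ∈ I, ¬ φ.Exact 6 x := fun x hx h => h.2 (h6 x hx h.1)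
  -- Values 1 and 2 are impossible: multiplying by x₅ or x₄ would produce value 6.
  have h13 : ∀ x ∈ I, x ∈ φ.F 1 → x ∈ φ.F 3 := by
    intro x hx hx1
    have hx2 : x ∈ φ.F 2 := by
      by_contra h
      exact hne _ (smul_mem φ.x₅ hx)
        (exact_x₅.mul 6 (exact_of_not hx1 2 h (by norm_num)) (by norm_num))
    by_contra h
    exact hne _ (smul_mem φ.x₄ hx)
      (exact_x₄.mul 6 (exact_of_not hx2 3 h (by norm_num)) (by norm_num))
  by_cases hE : ∃ y ∈ I, φ.Exact 3 y
  · right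
    obtain ⟨y, hyI, hy⟩ := hE
    have hyy := hy.mul 6 hy (by norm_num)
    -- Expand t³ = r y + a x₄ + b x₅ + s y² + f with f ∈ F 7; y² supplies the value 6, which I
    -- lacks.
    obtain ⟨r, hr⟩ := hy.approx exact_t_cube.1 4 (by norm_num)
    obtain ⟨a, ha⟩ := exact_x₄.approx hr 5 (by norm_num)
    obtain ⟨b, hb⟩ := exact_x₅.approx ha 6 (by norm_num)
    obtain ⟨s, hs⟩ := hyy.approx hb 7 (by norm_num)
    set f := φ.t ^ 3 - algebraMap R K r * y - algebraMap R K a * algebraMap R K φ.x₄ -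
      algebraMap R K b * algebraMap R K φ.x₅ - algebraMap R K s * (y * y) with hf
    have hFI : φ.F 7 ≤ I := φ.F7_le.trans (one_le_of_one_mem h1)
    have hrE : φ.Exact 0 (algebraMap R K r) := by
      refine exact_of_not (φ.coe_mem_F_zero r) 1 (fun h => ?_) (by norm_num)
      exact exact_t_cube.2 (mem_of_sub hr (mul_mem _ h hy.1 (by norm_num)))
    -- With this u the two terms r s y² in u t³ cancel, and the rest lies in R y + R + F 7 ⊆ I.
    set u := algebraMap R K r - algebraMap R K s * y with hu
    have hsy : algebraMap R K s * y ∈ φ.F 3 := smul_mem s hy.1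
    have huE : φ.Exact 0 u := by
      refine ⟨sub_mem hrE.1 (φ.anti (by norm_num) hsy), fun h => hrE.2 ?_⟩
      exact mem_of_sub h (φ.anti (by norm_num) hsy)
    have huI : u ∈ I := sub_mem (mem_of_one_mem h1 r) (smul_mem s hyI)
    have hut : u * φ.t ^ 3 ∈ I := by
      have e : u * φ.t ^ 3 = algebraMap R K (r * r) * y +
          algebraMap R K (r * (a * φ.x₄ + b * φ.x₅)) +
          (u * f - algebraMap R K (s * s) * (y * y * y)
            - algebraMap R K (s * (a * φ.x₄ + b * φ.x₅)) * y) := by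
        have e1 : φ.t ^ 3 = f + algebraMap R K r * y + algebraMap R K a * algebraMap R K φ.x₄ +
          algebraMap R K b * algebraMap R K φ.x₅ + algebraMap R K s * (y * y) := by
          rw [hf]
          ring
        rw [e1, hu]
        simp only [map_mul, map_add]
        ring
      rw [e]
      refine add_mem (add_mem (smul_mem _ hyI) (mem_of_one_mem h1 _)) (hFI ?_)
      refine sub_mem (sub_mem (mul_mem 7 huE.1 hs (by norm_num)) (smul_mem _ ?_)) ?_
      · exact mul_mem 7 hyy.1 hy.1 (by norm_num)
      · refine mul_mem 7 (?_ : _ ∈ φ.F 4) hy.1 (by norm_num)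
        rw [map_mul, map_add, map_mul, map_mul]
        exact smul_mem _ (add_mem (smul_mem _ exact_x₄.1)
          (smul_mem _ (φ.anti (by norm_num) exact_x₅.1)))
    refine ⟨u, huE.ne_zero, le_antisymm (fun x hx => ?_) ?_⟩
    · have huJ : ∀ i ∈ φ.canonicalIdeal, u * i ∈ spanSingleton R⁰ u * φ.canonicalIdeal :=
        fun i hi => mem_singleton_mul.2 ⟨i, hi, rfl⟩
      have huI' : ∀ i ∈ φ.canonicalIdeal, u * i ∈ I := by
        intro i hi
        obtain ⟨a, b, rfl⟩ := mem_canonicalIdeal.1 hi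
        have := add_mem (smul_mem a huI) (smul_mem b hut)
        convert this using 1
        ring
      -- I has only the values 0, 3, 4, 5 and those from 7 on, all attained in u C, so an element of
      -- I is cleared value by value by elements of u C.
      have step : ∀ {n : ℤ} (m : ℤ) {i : K}, φ.Exact n i → i ∈ φ.canonicalIdeal → m = n + 1 →
          ∀ x ∈ I, x ∈ φ.F n → (∀ y ∈ I, y ∈ φ.F m → y ∈ spanSingleton R⁰ u * φ.canonicalIdeal) →
          x ∈ spanSingleton R⁰ u * φ.canonicalIdeal := by
        intro n m i hi hiJ hm x hx hxn h
        obtain ⟨c, hc⟩ := (huE.mul n hi (by ring)).approx hxn m hm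
        exact mem_of_sub (h _ (sub_mem hx (smul_mem c (huI' i hiJ))) hc) (smul_mem c (huJ i hiJ))
      refine step 1 exact_one one_mem_canonicalIdeal (by norm_num) x hx (h0 hx) fun x hx hx1 => ?_
      refine step 4 exact_t_cube t_cube_mem_canonicalIdeal (by norm_num) x hx (h13 x hx hx1)
        fun x hx hx1 => ?_
      refine step 5 exact_x₄ (one_le_canonicalIdeal (coe_mem_one _)) (by norm_num) x hx hx1
        fun x hx hx1 => ?_
      refine step 6 exact_x₅ (one_le_canonicalIdeal (coe_mem_one _)) (by norm_num) x hx hx1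
        fun x hx hx1 => ?_
      rw [mem_spanSingleton_mul_iff huE.ne_zero]
      refine one_le_canonicalIdeal (φ.F7_le ?_)
      exact mul_mem 7 (huE.inv 0 (by norm_num)).1 (h6 x hx hx1) (by norm_num)
    · intro x hx
      obtain ⟨i, hi, rfl⟩ := mem_singleton_mul.1 hx
      obtain ⟨a, b, rfl⟩ := mem_canonicalIdeal.1 hi
      have := add_mem (smul_mem a huI) (smul_mem b hut)
      convert this using 1
      ring
  · left
    refine le_antisymm (fun x hx => ?_) (one_le_of_one_mem h1)
    obtain ⟨r, hr⟩ := exact_one.approx (h0 hx) 1 (by norm_num)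
    have hxr := sub_mem hx (smul_mem r h1)
    have h4 : x - algebraMap R K r * 1 ∈ φ.F 4 := by
      by_contra h
      exact hE ⟨_, hxr, exact_of_not (h13 _ hxr hr) 4 h (by norm_num)⟩
    exact mem_of_sub (mem_one_of_mem_F6 h1 h6 hxr h4) (smul_mem r (by simp))

end ValueFiltration

/-! ### Classification of normal modules. -/

namespace ValueFiltration

variable {R K : Type*} [CommRing R] [IsDomain R] [IsLocalRing R] [Field K]
    [Algebra R K] [IsFractionRing R K]

/-- The module `R + R y₁ + R y₂ + F 4`. -/
noncomputable def adjoin (φ : ValueFiltration R K) (y₁ y₂ : K) : FractionalIdeal R⁰ K :=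
  1 ⊔ spanSingleton R⁰ y₁ ⊔ spanSingleton R⁰ y₂ ⊔ φ.F 4

variable {φ : ValueFiltration R K}

theorem mem_adjoin {y₁ y₂ x : K} : x ∈ φ.adjoin y₁ y₂ ↔ ∃ a b c : R, ∃ f ∈ φ.F 4,
    x = algebraMap R K a + algebraMap R K b * y₁ + algebraMap R K c * y₂ + f := by
  simp only [adjoin, sup_eq_add, mem_add, mem_one_iff, mem_spanSingleton, Algebra.smul_def]
  constructor
  · rintro ⟨_, ⟨_, ⟨_, ⟨a, rfl⟩, _, ⟨b, rfl⟩, rfl⟩, _, ⟨c, rfl⟩, rfl⟩, f, hf, rfl⟩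
    exact ⟨a, b, c, f, hf, rfl⟩
  · rintro ⟨a, b, c, f, hf, rfl⟩
    exact ⟨_, ⟨_, ⟨_, ⟨a, rfl⟩, _, ⟨b, rfl⟩, rfl⟩, _, ⟨c, rfl⟩, rfl⟩, f, hf, rfl⟩

theorem one_mem_adjoin (y₁ y₂ : K) : (1 : K) ∈ φ.adjoin y₁ y₂ :=
  mem_adjoin.2 ⟨1, 0, 0, 0, zero_mem _, by simp⟩

theorem left_mem_adjoin (y₁ y₂ : K) : y₁ ∈ φ.adjoin y₁ y₂ :=
  mem_adjoin.2 ⟨0, 1, 0, 0, zero_mem _, by simp⟩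

theorem right_mem_adjoin (y₁ y₂ : K) : y₂ ∈ φ.adjoin y₁ y₂ :=
  mem_adjoin.2 ⟨0, 0, 1, 0, zero_mem _, by simp⟩

theorem F4_le_adjoin (y₁ y₂ : K) : φ.F 4 ≤ φ.adjoin y₁ y₂ := le_sup_right

theorem mul_mem_of_adjoin {y₁ y₂ w : K} {I : FractionalIdeal R⁰ K} (hw : w ∈ φ.F 0)
    (hF : φ.F 4 ≤ I) (h1 : w ∈ I) (h2 : w * y₁ ∈ I) (h3 : w * y₂ ∈ I) :
    ∀ x ∈ φ.adjoin y₁ y₂, w * x ∈ I := by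
  intro x hx
  obtain ⟨a, b, c, f, hf, rfl⟩ := mem_adjoin.1 hx
  have := add_mem (add_mem (add_mem (smul_mem a h1) (smul_mem b h2)) (smul_mem c h3))
    (hF (mul_mem 4 hw hf (by norm_num)))
  convert this using 1
  ring

/-- A coefficient that raises the value of y is a nonunit of R, hence has value at least 4. -/
theorem coe_mul_mem_four {n : ℤ} {y : K} (hn : 0 ≤ n) (hy : φ.Exact n y) {b : R}
    (h : algebraMap R K b * y ∈ φ.F (n + 1)) : algebraMap R K b * y ∈ φ.F 4 := by
  rw [mul_comm, hy.mul_mem_iff 1 (n + 1) (by ring)] at h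
  exact mul_mem 4 (coe_mem_four h) hy.1 (by omega)

/-- Nonunit coefficients have value at least 4, so the first terms drop out modulo F 4. Allowing a
generator to be 0 covers all four types of normal module at once. -/
theorem adjoin_mem {y₁ y₂ : K} (h₁ : y₁ = 0 ∨ φ.Exact 1 y₁) (h₂ : y₂ = 0 ∨ φ.Exact 2 y₂) :
    (∀ x ∈ φ.adjoin y₁ y₂, x ∈ φ.F 1 →
      ∃ b : R, x - algebraMap R K b * y₁ ∈ φ.adjoin 0 y₂ ∧
        x - algebraMap R K b * y₁ ∈ φ.F 2) ∧
    (∀ x ∈ φ.adjoin y₁ y₂, x ∈ φ.F 2 →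
      ∃ c : R, x - algebraMap R K c * y₂ ∈ φ.F 4) := by
  have h₁F : y₁ ∈ φ.F 1 := by
    rcases h₁ with rfl | h
    exacts [zero_mem _, h.1]
  have h₂F : y₂ ∈ φ.F 2 := by
    rcases h₂ with rfl | h
    exacts [zero_mem _, h.1]
  have key : ∀ a b c : R, ∀ f ∈ φ.F 4,
      algebraMap R K a + algebraMap R K b * y₁ + algebraMap R K c * y₂ + f ∈ φ.F 1 →
      algebraMap R K a ∈ φ.F 4 := by
    intro a b c f hf hx
    refine coe_mem_four ?_
    have := sub_mem hx (add_mem (add_mem (smul_mem b h₁F)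
      (smul_mem c (φ.anti (by norm_num) h₂F))) (φ.anti (by norm_num) hf))
    convert this using 1
    ring
  constructor
  · intro x hx hx1
    obtain ⟨a, b, c, f, hf, rfl⟩ := mem_adjoin.1 hx
    have ha := key a b c f hf hx1
    refine ⟨b, mem_adjoin.2 ⟨a, 0, c, f, hf, by simp; ring⟩, ?_⟩
    have := add_mem (φ.anti (by norm_num : (2 : ℤ) ≤ 4) (add_mem ha hf)) (smul_mem c h₂F)
    convert this using 1
    ring
  · intro x hx hx2
    obtain ⟨a, b, c, f, hf, rfl⟩ := mem_adjoin.1 hx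
    have ha := key a b c f hf (φ.anti (by norm_num) hx2)
    refine ⟨c, ?_⟩
    have hb : algebraMap R K b * y₁ ∈ φ.F 4 := by
      rcases h₁ with rfl | h
      · simp [FractionalIdeal.zero_mem]
      refine coe_mul_mem_four (by norm_num) h ?_
      have := sub_mem hx2 (add_mem (φ.anti (by norm_num) (add_mem ha hf)) (smul_mem c h₂F))
      norm_num
      convert this using 1
      ring
    convert add_mem (add_mem ha hf) hb using 1
    ring

theorem isNormal_adjoin {y₁ y₂ : K} (h₁ : y₁ = 0 ∨ φ.Exact 1 y₁) (h₂ : y₂ = 0 ∨ φ.Exact 2 y₂) :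
    φ.IsNormal (φ.adjoin y₁ y₂) where
  one_mem := one_mem_adjoin _ _
  F4_le := F4_le_adjoin _ _
  le_F0 := by
    refine sup_le (sup_le (sup_le φ.one_le ?_) ?_) (φ.anti (by norm_num))
    · rw [spanSingleton_le_iff_mem]
      rcases h₁ with rfl | h
      exacts [zero_mem _, φ.anti (by norm_num) h.1]
    · rw [spanSingleton_le_iff_mem]
      rcases h₂ with rfl | h
      exacts [zero_mem _, φ.anti (by norm_num) h.1]
  mem_four := by
    intro x hx hx3
    obtain ⟨c, hc⟩ := (adjoin_mem h₁ h₂).2 x hx (φ.anti (by norm_num) hx3)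
    have : algebraMap R K c * y₂ ∈ φ.F 4 := by
      rcases h₂ with rfl | h
      · simp [FractionalIdeal.zero_mem]
      refine coe_mul_mem_four (by norm_num) h ?_
      norm_num
      simpa using sub_mem hx3 (φ.anti (by norm_num) hc)
    exact mem_of_sub hc this

theorem not_exact_one_of_adjoin {y₂ x : K} (h₂ : y₂ = 0 ∨ φ.Exact 2 y₂)
    (hx : x ∈ φ.adjoin 0 y₂) : ¬ φ.Exact 1 x := by
  intro h
  obtain ⟨b, -, hb⟩ := (adjoin_mem (Or.inl rfl) h₂).1 x hx h.1
  exact h.2 (by simpa using hb)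

theorem not_exact_two_of_adjoin {y₁ x : K} (h₁ : y₁ = 0 ∨ φ.Exact 1 y₁)
    (hx : x ∈ φ.adjoin y₁ 0) : ¬ φ.Exact 2 x := by
  intro h
  obtain ⟨b, hb⟩ := (adjoin_mem h₁ (Or.inl rfl)).2 x hx h.1
  exact h.2 (φ.anti (by norm_num : (2 : ℤ) + 1 ≤ 4) (by simpa using hb))

/-- Given u J ⊆ I with u of value 0, equality is a question of values only, and for normal modules
only the values 1 and 2 can differ. -/
theorem IsNormal.eq_smul_of_forall_mem {I J : FractionalIdeal R⁰ K} (hI : φ.IsNormal I)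
    (hJ : φ.IsNormal J) {u : K} (hu : φ.Exact 0 u) (h : ∀ x ∈ J, u * x ∈ I)
    (hE1 : ∀ x ∈ I, φ.Exact 1 x → ∃ y ∈ J, φ.Exact 1 y)
    (hE2 : ∀ x ∈ I, φ.Exact 2 x → ∃ y ∈ J, φ.Exact 2 y) :
    I = spanSingleton R⁰ u * J := by
  refine le_antisymm (fun x hx => ?_) (fun x hx => ?_)
  · have step : ∀ {n : ℤ} (m : ℤ) {i : K}, φ.Exact n i → i ∈ J → m = n + 1 →
        ∀ x ∈ I, x ∈ φ.F n → (∀ y ∈ I, y ∈ φ.F m → y ∈ spanSingleton R⁰ u * J) →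
        x ∈ spanSingleton R⁰ u * J := by
      intro n m i hi hiJ hm x hx hxn hyp
      obtain ⟨c, hc⟩ := (hu.mul n hi (by ring)).approx hxn m hm
      exact mem_of_sub (hyp _ (sub_mem hx (smul_mem c (h i hiJ))) hc)
        (smul_mem c (mem_singleton_mul.2 ⟨i, hiJ, rfl⟩))
    have h3 : ∀ x ∈ I, x ∈ φ.F 3 → x ∈ spanSingleton R⁰ u * J := by
      intro x hx hx3
      rw [mem_spanSingleton_mul_iff hu.ne_zero]
      exact hJ.F4_le (mul_mem 4 (hu.inv 0 (by norm_num)).1 (hI.mem_four x hx hx3) (by norm_num))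
    have h2 : ∀ x ∈ I, x ∈ φ.F 2 → x ∈ spanSingleton R⁰ u * J := by
      intro x hx hx2
      by_cases hx3 : x ∈ φ.F 3
      · exact h3 x hx hx3
      · obtain ⟨y, hy, hyE⟩ := hE2 x hx (exact_of_not hx2 3 hx3 (by norm_num))
        exact step 3 hyE hy (by norm_num) x hx hx2 h3
    refine step 1 exact_one hJ.one_mem (by norm_num) x hx (hI.le_F0 hx) fun x hx hx1 => ?_
    by_cases hx2 : x ∈ φ.F 2
    · exact h2 x hx hx2
    · obtain ⟨y, hy, hyE⟩ := hE1 x hx (exact_of_not hx1 2 hx2 (by norm_num))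
      exact step 2 hyE hy (by norm_num) x hx hx1 h2
  · obtain ⟨y, hy, rfl⟩ := mem_singleton_mul.1 hx
    exact h y hy

/-- A multiple of a normal module containing another one, but not its divisorial closure, has a
multiplier of value zero. -/
theorem IsNormal.exact_zero {I J : FractionalIdeal R⁰ K} (hI : φ.IsNormal I) (hJ : φ.IsNormal J)
    {c : K} (hc : c ≠ 0) (hle : I ≤ spanSingleton R⁰ c * J)
    (hnle : ¬ divClosure I ≤ spanSingleton R⁰ c * J) : φ.Exact 0 c := by
  obtain ⟨n, hn⟩ : ∃ n, φ.Exact n c := φ.exists_exact hc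
  have h1 := hle hI.one_mem
  rw [mem_spanSingleton_mul_iff hc, mul_one] at h1
  have hinv := hn.inv (-n) rfl
  have hn0 : n ≤ 0 := by
    by_contra h
    exact hinv.2 (φ.anti (by omega) (hJ.le_F0 h1))
  rcases eq_or_lt_of_le hn0 with rfl | hlt
  · exact hn
  · refine absurd ?_ hnle
    rw [hI.divClosure_eq]
    refine sup_le hle fun f hf => ?_
    rw [mem_spanSingleton_mul_iff hc]
    exact hJ.F4_le (mul_mem 4 hinv.1 hf (by omega))

/-- The closure of I contains t³, but w t³ has value 3 and so is not in J. -/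
theorem IsNormal.exists_of_exact_zero {I J : FractionalIdeal R⁰ K} (hI : φ.IsNormal I)
    (hJ : φ.IsNormal J) {w : K} (hw : φ.Exact 0 w) (h : ∀ x ∈ I, w * x ∈ J) :
    ∃ c : K, c ≠ 0 ∧ I ≤ spanSingleton R⁰ c * J ∧ ¬ divClosure I ≤ spanSingleton R⁰ c * J := by
  refine ⟨w⁻¹, inv_ne_zero hw.ne_zero, fun x hx => ?_, fun hle => ?_⟩
  · rw [mem_spanSingleton_mul_iff (inv_ne_zero hw.ne_zero), inv_inv]
    exact h x hx
  · have := hle (hI.F3_le_divClosure exact_t_cube.1)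
    rw [mem_spanSingleton_mul_iff (inv_ne_zero hw.ne_zero), inv_inv] at this
    exact hJ.not_exact_three (hw.mul 3 exact_t_cube (by norm_num)) this

/-- A multiple of a normal module containing the canonical ideal contains its divisorial closure. -/
theorem IsNormal.divClosure_canonicalIdeal_le {J : FractionalIdeal R⁰ K} (hJ : φ.IsNormal J)
    {c : K} (hc : c ≠ 0) (hle : φ.canonicalIdeal ≤ spanSingleton R⁰ c * J) :
    divClosure φ.canonicalIdeal ≤ spanSingleton R⁰ c * J := by
  rw [divClosure_canonicalIdeal]
  refine sup_le (one_le_canonicalIdeal.trans hle) ?_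
  refine F_le_of_exact exact_t_cube (hle t_cube_mem_canonicalIdeal) (m := 4) ?_ (by norm_num)
  intro f hf
  have h1 := hle one_mem_canonicalIdeal
  rw [mem_spanSingleton_mul_iff hc] at h1 ⊢
  rw [mul_one] at h1
  exact hJ.F4_le (mul_mem 4 (hJ.le_F0 h1) hf (by norm_num))

/-! ### Representatives -/

/-- A lift of a residue class. -/
noncomputable def lift (a : IsLocalRing.ResidueField R) : R :=
  Function.surjInv IsLocalRing.residue_surjective a

theorem residue_lift (a : IsLocalRing.ResidueField R) : IsLocalRing.residue R (lift a) = a :=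
  Function.surjInv_eq _ _

theorem lift_sub_mem (φ : ValueFiltration R K) (r : R) :
    algebraMap R K (lift (IsLocalRing.residue R r)) - algebraMap R K r ∈ φ.F 4 := by
  rw [← map_sub]
  refine coe_mem_four ((φ.mem_maximal _).1 ?_)
  rw [← IsLocalRing.residue_eq_zero_iff, map_sub, residue_lift, sub_self]

theorem lift_inj (φ : ValueFiltration R K) {a b : IsLocalRing.ResidueField R}
    (h : algebraMap R K (lift a) - algebraMap R K (lift b) ∈ φ.F 1) : a = b := by
  rw [← map_sub, ← φ.mem_maximal, ← IsLocalRing.residue_eq_zero_iff, map_sub, residue_lift,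
    residue_lift] at h
  exact sub_eq_zero.1 h

/-- `t + r t³`. -/
noncomputable def lin (φ : ValueFiltration R K) (r : R) : K := φ.t + algebraMap R K r * φ.t ^ 3

/-- `t² + r t³`. -/
noncomputable def quad (φ : ValueFiltration R K) (r : R) : K :=
  φ.t ^ 2 + algebraMap R K r * φ.t ^ 3

theorem Exact.add {n : ℤ} {x y : K} (hx : φ.Exact n x) (hy : y ∈ φ.F (n + 1)) :
    φ.Exact n (x + y) :=
  ⟨add_mem hx.1 (φ.anti (by omega) hy), fun h => hx.2 (by simpa using sub_mem h hy)⟩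

theorem exact_lin (r : R) : φ.Exact 1 (φ.lin r) :=
  exact_t.add (smul_mem r (φ.anti (by norm_num) exact_t_cube.1))

theorem exact_quad (r : R) : φ.Exact 2 (φ.quad r) :=
  exact_t_sq.add (smul_mem r exact_t_cube.1)

theorem t_pow_four_mul_mem {x : K} (hx : x ∈ φ.F 0) : φ.t ^ 4 * x ∈ φ.F 4 := by
  rw [pow_succ]
  exact mul_mem 4 (exact_t_cube.mul 4 exact_t (by norm_num)).1 hx (by norm_num)

/-- Representatives of the classes of nondivisorial ideals. -/
noncomputable def rep (φ : ValueFiltration R K) :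
    IdealClassLabel (IsLocalRing.ResidueField R ⊕ IsLocalRing.ResidueField R) →
      FractionalIdeal R⁰ K
  | .canonical => φ.canonicalIdeal
  | .hyperplane => φ.adjoin φ.t (φ.t ^ 2)
  | .middle (.inl a) => φ.adjoin 0 (φ.quad (lift a))
  | .middle (.inr a) => φ.adjoin (φ.lin (lift a)) 0
  | .least => φ.adjoin 0 0

theorem isNormal_rep {x : IdealClassLabel (IsLocalRing.ResidueField R ⊕ IsLocalRing.ResidueField R)}
    (hx : x ≠ .canonical) : φ.IsNormal (φ.rep x) := by
  match x, hx with
  | .hyperplane, _ => exact isNormal_adjoin (Or.inr exact_t) (Or.inr exact_t_sq)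
  | .middle (.inl a), _ => exact isNormal_adjoin (Or.inl rfl) (Or.inr (exact_quad _))
  | .middle (.inr a), _ => exact isNormal_adjoin (Or.inr (exact_lin _)) (Or.inl rfl)
  | .least, _ => exact isNormal_adjoin (Or.inl rfl) (Or.inl rfl)

/-! ### Classification of normal modules -/

theorem IsNormal.quad_mem {I : FractionalIdeal R⁰ K} (hI : φ.IsNormal I) {y : K} (hy : y ∈ I)
    (hyE : φ.Exact 2 y) : ∃ b : R, φ.quad b ∈ I := by
  obtain ⟨r, hr⟩ := hyE.approx exact_t_sq.1 3 (by norm_num)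
  obtain ⟨s, hs⟩ := exact_t_cube.approx hr 4 (by norm_num)
  refine ⟨-s, mem_of_sub (hI.F4_le ?_) (smul_mem r hy)⟩
  convert hs using 1
  rw [quad, map_neg]
  ring

theorem IsNormal.exists_lin_mem {I : FractionalIdeal R⁰ K} (hI : φ.IsNormal I) {y : K} (hy : y ∈ I)
    (hyE : φ.Exact 1 y) :
    ∃ a b : R, φ.t + algebraMap R K a * φ.t ^ 2 + algebraMap R K b * φ.t ^ 3 ∈ I := by
  obtain ⟨r, hr⟩ := hyE.approx exact_t.1 2 (by norm_num)
  obtain ⟨s, hs⟩ := exact_t_sq.approx hr 3 (by norm_num)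
  obtain ⟨s', hs'⟩ := exact_t_cube.approx hs 4 (by norm_num)
  refine ⟨-s, -s', mem_of_sub (hI.F4_le ?_) (smul_mem r hy)⟩
  convert hs' using 1
  rw [map_neg, map_neg]
  ring

/-- Only the residue class of a coefficient matters: passing to its chosen lift changes the element
within F 4. -/
theorem lift_smul_mem {I : FractionalIdeal R⁰ K} (hF : φ.F 4 ≤ I) {w x y : K} (r : R)
    (hx : w + algebraMap R K r * y + x ∈ I) (hy : y ∈ φ.F 0) :
    w + algebraMap R K (lift (IsLocalRing.residue R r)) * y + x ∈ I := by
  refine mem_of_sub (hF ?_) hx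
  convert mul_mem 4 (φ.lift_sub_mem r) hy (by norm_num) using 1
  ring

theorem t_mem_zero : φ.t ∈ φ.F 0 := φ.anti (by norm_num) exact_t.1

theorem IsNormal.exists_eq_smul_rep {I : FractionalIdeal R⁰ K} (hI : φ.IsNormal I) :
    ∃ x, ∃ u, u ≠ 0 ∧ I = spanSingleton R⁰ u * φ.rep x := by
  have ht3 : φ.t ^ 3 ∈ φ.F 0 := φ.anti (by norm_num) exact_t_cube.1
  by_cases hE1 : ∃ y ∈ I, φ.Exact 1 y
  · obtain ⟨y₁, hy₁, hy₁E⟩ := hE1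
    obtain ⟨a, b, hab⟩ := hI.exists_lin_mem hy₁ hy₁E
    by_cases hE2 : ∃ y ∈ I, φ.Exact 2 y
    · obtain ⟨y₂, hy₂, hy₂E⟩ := hE2
      obtain ⟨d, hd⟩ := hI.quad_mem hy₂ hy₂E
      have hc : φ.lin (b - a * d) ∈ I := by
        convert sub_mem hab (smul_mem a hd) using 1
        simp only [lin, quad, map_sub, map_mul]
        ring
      set c := b - a * d
      -- Modulo F 3, u is 1 + d t + (c + d²) t². The coefficients are chosen so that, modulo F 4, u
      -- t is t + c t³ + d (t² + d t³) and u t² is t² + d t³, both in I.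
      set u : K := 1 + (algebraMap R K d * φ.lin c + algebraMap R K (c + d * d) * φ.quad d)
      have huE : φ.Exact 0 u := exact_one.add (add_mem (smul_mem _ (exact_lin c).1)
        (smul_mem _ (φ.anti (by norm_num) (exact_quad d).1)))
      have huI : u ∈ I := add_mem hI.one_mem (add_mem (smul_mem _ hc) (smul_mem _ hd))
      refine ⟨.hyperplane, u, huE.ne_zero, hI.eq_smul_of_forall_mem (isNormal_rep (by simp)) huE
        (mul_mem_of_adjoin huE.1 hI.F4_le huI ?_ ?_)
        (fun _ _ _ => ⟨_, left_mem_adjoin _ _, exact_t⟩)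
        (fun _ _ _ => ⟨_, right_mem_adjoin _ _, exact_t_sq⟩)⟩
      · refine mem_of_sub (hI.F4_le ?_) (add_mem hc (smul_mem d hd))
        convert t_pow_four_mul_mem (add_mem (φ.coe_mem_F_zero (d * c))
          (smul_mem (c + d * d) (φ.coe_mem_F_zero d))) using 1
        simp only [u, lin, quad, map_add, map_mul]
        ring
      · refine mem_of_sub (hI.F4_le ?_) hd
        convert t_pow_four_mul_mem (add_mem (add_mem (smul_mem d (smul_mem c t_mem_zero))
          (φ.coe_mem_F_zero (c + d * d))) (smul_mem (c + d * d) (smul_mem d t_mem_zero))) using 1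
        simp only [u, lin, quad, map_add, map_mul]
        ring
    · set y := φ.t + algebraMap R K a * φ.t ^ 2 + algebraMap R K b * φ.t ^ 3
      -- Modulo F 3, u is 1 + a t + a² t², so u t already accounts for a t² and a² t³ in y; the
      -- coefficient of t³ that remains is b - a².
      set u : K := 1 + algebraMap R K a * y
      have hyF : y ∈ φ.F 1 := add_mem (add_mem exact_t.1 (smul_mem _ (φ.anti (by norm_num)
        exact_t_sq.1))) (smul_mem _ (φ.anti (by norm_num) exact_t_cube.1))
      have huE : φ.Exact 0 u := exact_one.add (smul_mem _ hyF)
      have huI : u ∈ I := add_mem hI.one_mem (smul_mem _ hab)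
      set d := b - a * a
      refine ⟨.middle (.inr (IsLocalRing.residue R d)), u, huE.ne_zero,
        hI.eq_smul_of_forall_mem (isNormal_rep (by simp)) huE
        (mul_mem_of_adjoin huE.1 hI.F4_le huI ?_ (by simp [FractionalIdeal.zero_mem]))
        (fun _ _ _ => ⟨_, left_mem_adjoin _ _, exact_lin _⟩)
        (fun x hx h => absurd ⟨x, hx, h⟩ hE2)⟩
      have : u * φ.t + algebraMap R K d * (u * φ.t ^ 3) + 0 ∈ I := by
        refine mem_of_sub (hI.F4_le ?_) hab
        convert t_pow_four_mul_mem (add_mem (φ.coe_mem_F_zero (a * b))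
          (smul_mem (d * a) (add_mem (add_mem (φ.coe_mem_F_zero 1)
            (smul_mem a t_mem_zero))
            (smul_mem b (φ.anti (by norm_num : (0 : ℤ) ≤ 2) exact_t_sq.1))))) using 1
        simp only [u, y, d, map_sub, map_mul, map_one]
        ring
      have := lift_smul_mem hI.F4_le d this (mul_mem 0 huE.1 ht3 (by norm_num))
      convert this using 1
      rw [lin]
      ring
  · by_cases hE2 : ∃ y ∈ I, φ.Exact 2 y
    · obtain ⟨y₂, hy₂, hy₂E⟩ := hE2
      obtain ⟨d, hd⟩ := hI.quad_mem hy₂ hy₂E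
      refine ⟨.middle (.inl (IsLocalRing.residue R d)), 1, one_ne_zero,
        hI.eq_smul_of_forall_mem (isNormal_rep (by simp)) exact_one
        (mul_mem_of_adjoin exact_one.1 hI.F4_le hI.one_mem (by simp [FractionalIdeal.zero_mem]) ?_)
        (fun x hx h => absurd ⟨x, hx, h⟩ hE1)
        (fun _ _ _ => ⟨_, right_mem_adjoin _ _, exact_quad _⟩)⟩
      have := lift_smul_mem hI.F4_le (x := 0) d (by simpa [quad] using hd) ht3
      simpa [quad] using this
    · exact ⟨.least, 1, one_ne_zero,
        hI.eq_smul_of_forall_mem (isNormal_rep (by simp)) exact_one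
        (mul_mem_of_adjoin exact_one.1 hI.F4_le hI.one_mem (by simp [FractionalIdeal.zero_mem])
          (by simp [FractionalIdeal.zero_mem]))
        (fun x hx h => absurd ⟨x, hx, h⟩ hE1) (fun x hx h => absurd ⟨x, hx, h⟩ hE2)⟩

/-- Every nonzero fractional ideal has a multiple between `R` and the valuation ring. -/
theorem exists_smul_le (φ : ValueFiltration R K) {I : FractionalIdeal R⁰ K} (hI : I ≠ 0) :
    ∃ c : K, c ≠ 0 ∧ (1 : K) ∈ spanSingleton R⁰ c * I ∧ spanSingleton R⁰ c * I ≤ φ.F 0 := by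
  obtain ⟨d, hd, hdI⟩ := I.isFractional
  have hd0 : algebraMap R K d ≠ 0 := fun h =>
    nonZeroDivisors.ne_zero hd (IsFractionRing.injective R K (by rw [h, map_zero]))
  obtain ⟨m, hm⟩ := φ.exists_exact hd0
  have hbd : ∀ n : ℤ, (∃ x ∈ I, φ.Exact n x) → -m ≤ n := by
    rintro n ⟨x, hx, hxn⟩
    obtain ⟨r, hr⟩ := hdI x hx
    rw [Algebra.smul_def] at hr
    by_contra h
    have := (Exact.mul (m + n) hm hxn rfl).notMem 0 (by omega)
    exact this (hr ▸ φ.coe_mem_F_zero r)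
  have hex : ∃ n : ℤ, ∃ x ∈ I, φ.Exact n x := by
    by_contra h
    refine hI (eq_zero_iff.2 fun x hx => by_contra fun hx0 => ?_)
    obtain ⟨n, hn⟩ := φ.exists_exact hx0
    exact h ⟨n, x, hx, hn⟩
  -- The denominator bounds the values of I below; dividing by an element of least value normalizes
  -- I.
  obtain ⟨n, ⟨x, hx, hxn⟩, hmin⟩ := Int.exists_least_of_bdd ⟨-m, hbd⟩ hex
  refine ⟨x⁻¹, inv_ne_zero hxn.ne_zero, ?_, fun y hy => ?_⟩
  · rw [mem_spanSingleton_mul_iff (inv_ne_zero hxn.ne_zero), inv_inv, mul_one]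
    exact hx
  · rw [mem_spanSingleton_mul_iff (inv_ne_zero hxn.ne_zero), inv_inv] at hy
    rw [← hxn.mul_mem_iff 0 n (by ring)]
    rcases eq_or_ne (x * y) 0 with h0 | h0
    · rw [h0]
      exact zero_mem _
    · obtain ⟨k, hk⟩ := φ.exists_exact h0
      exact φ.anti (hmin k ⟨_, hy, hk⟩) hk.1

/-- The value 6 decides whether F 4 ⊆ I; given that, the value 3 decides between divisorial and
normal. -/
theorem divClosure_eq_or_exists (φ : ValueFiltration R K) (I : FractionalIdeal R⁰ K) :
    divClosure I = I ∨ ∃ x, ∃ c : K, c ≠ 0 ∧ I = spanSingleton R⁰ c * φ.rep x := by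
  rcases eq_or_ne I 0 with rfl | hI
  · exact Or.inl divClosure_zero
  obtain ⟨c, hc, h1, h0⟩ := φ.exists_smul_le hI
  suffices h : divClosure (spanSingleton R⁰ c * I) = spanSingleton R⁰ c * I ∨
      ∃ x, ∃ d : K, d ≠ 0 ∧ spanSingleton R⁰ c * I = spanSingleton R⁰ d * φ.rep x by
    rcases h with h | ⟨x, d, hd, h⟩
    · left
      rw [divClosure_smul hc] at h
      rw [← spanSingleton_inv_mul_cancel hc (divClosure I), h, spanSingleton_inv_mul_cancel hc]
    · right
      refine ⟨x, c⁻¹ * d, mul_ne_zero (inv_ne_zero hc) hd, ?_⟩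
      rw [← spanSingleton_mul_spanSingleton, mul_assoc, ← h, spanSingleton_inv_mul_cancel hc]
  generalize spanSingleton R⁰ c * I = J at h1 h0
  by_cases h6 : ∃ w ∈ J, φ.Exact 6 w
  · obtain ⟨w, hwJ, hw⟩ := h6
    have h4 := F4_le_of_exact_six h1 hw hwJ
    by_cases h3 : ∃ w ∈ J, φ.Exact 3 w
    · obtain ⟨w, hwJ, hw⟩ := h3
      exact Or.inl (divClosure_eq_of_F3_le h1 (F_le_of_exact hw hwJ h4 (by norm_num)) h0)
    · right
      refine IsNormal.exists_eq_smul_rep ⟨h1, h4, h0, fun x hx hx3 => by_contra fun h => h3 ?_⟩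
      exact ⟨x, hx, exact_of_not hx3 4 h (by norm_num)⟩
  · rcases eq_one_or_eq_canonicalIdeal h1 h0 (φ := φ) (fun x hx hx6 => by_contra fun h =>
      h6 ⟨x, hx, exact_of_not hx6 7 h (by norm_num)⟩) with rfl | ⟨u, hu, h⟩
    · exact Or.inl divClosure_one
    · exact Or.inr ⟨.canonical, u, hu, h⟩

end ValueFiltration

/-! ### Which representative forces which. -/

namespace ValueFiltration

variable {R K : Type*} [CommRing R] [IsDomain R] [IsLocalRing R] [Field K]
    [Algebra R K] [IsFractionRing R K] {φ : ValueFiltration R K}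

theorem exact_t_pow (φ : ValueFiltration R K) (n : ℕ) : φ.Exact n (φ.t ^ n) := by
  induction n with
  | zero => simpa using exact_one
  | succ n ih =>
    rw [pow_succ]
    exact ih.mul _ exact_t (by push_cast; rfl)

/-- Modulo F 7, R fails to fill F 4 only in value 6, where t⁶ takes over. -/
theorem exists_sub_mem_seven {y : K} (hy : y ∈ φ.F 4) :
    ∃ a p : R, y - algebraMap R K a - algebraMap R K p * φ.t ^ 6 ∈ φ.F 7 := by
  obtain ⟨r, hr⟩ := exact_x₄.approx hy 5 (by norm_num)
  obtain ⟨s, hs⟩ := exact_x₅.approx hr 6 (by norm_num)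
  obtain ⟨p, hp⟩ := (φ.exact_t_pow 6).approx hs 7 (by norm_num)
  refine ⟨r * φ.x₄ + s * φ.x₅, p, ?_⟩
  convert hp using 1
  simp only [map_add, map_mul]
  ring

/-- This is why C forces the normal classes. Value 3 for the multiplier sends t³, which lies in
every normal closure, to value 6, outside C. -/
theorem exists_mul_hyperplane_mem_canonical (φ : ValueFiltration R K) :
    ∃ c, φ.Exact 3 c ∧ ∀ x ∈ φ.rep .hyperplane, c * x ∈ φ.canonicalIdeal := by
  obtain ⟨a, p, hap⟩ := exists_sub_mem_seven (φ.exact_t_pow 4).1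
  obtain ⟨b, s, hbs⟩ := exists_sub_mem_seven (φ.anti (by norm_num) (φ.exact_t_pow 5).1)
  set f := φ.t ^ 4 - algebraMap R K a - algebraMap R K p * φ.t ^ 6 with hf
  set g := φ.t ^ 5 - algebraMap R K b - algebraMap R K s * φ.t ^ 6 with hg
  have ha : algebraMap R K a = φ.t ^ 4 - algebraMap R K p * φ.t ^ 6 - f := by
    rw [hf]
    ring
  have hb : algebraMap R K b = φ.t ^ 5 - algebraMap R K s * φ.t ^ 6 - g := by
    rw [hg]
    ring
  have ht : φ.t ∈ φ.F 0 := t_mem_zero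
  have ht2 : φ.t ^ 2 ∈ φ.F 0 := φ.anti (by norm_num) exact_t_sq.1
  have h7 : ∀ {z : K}, z ∈ φ.F 0 → φ.t ^ 7 * z ∈ φ.F 7 := fun hz =>
    mul_mem 7 (φ.exact_t_pow 7).1 hz (by norm_num)
  have h70 : ∀ {z w : K}, z ∈ φ.F 0 → w ∈ φ.F 7 → z * w ∈ φ.F 7 := fun hz hw =>
    mul_mem 7 hz hw (by norm_num)
  have hF7 : φ.F 7 ≤ φ.canonicalIdeal := φ.F7_le.trans one_le_canonicalIdeal
  have hR : ∀ r : R, algebraMap R K r ∈ φ.canonicalIdeal := fun r =>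
    one_le_canonicalIdeal (coe_mem_one r)
  -- Modulo F 7, a = t⁴ - p t⁶ and b = t⁵ - s t⁶. With c = t³ - s a + β b this gives c t² ≡ b and c
  -- t ≡ t⁴ - s t⁵ + β t⁶, and the latter is a - s b exactly for β = s² - p.
  set β := s * s - p with hβ
  set c := φ.t ^ 3 + (algebraMap R K (-s * a + β * b)) with hc
  have hcE : φ.Exact 3 c := by
    refine exact_t_cube.add (φ.mem_four (coe_mem_one _) ?_)
    have ha4 : algebraMap R K a ∈ φ.F 1 := by
      rw [ha]
      exact φ.anti (by norm_num : (1 : ℤ) ≤ 4) (sub_mem (sub_mem (φ.exact_t_pow 4).1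
        (smul_mem _ (φ.anti (by norm_num) (φ.exact_t_pow 6).1))) (φ.anti (by norm_num) hap))
    have hb4 : algebraMap R K b ∈ φ.F 1 := by
      rw [hb]
      exact φ.anti (by norm_num : (1 : ℤ) ≤ 4) (sub_mem (sub_mem (φ.anti (by norm_num)
        (φ.exact_t_pow 5).1) (smul_mem _ (φ.anti (by norm_num) (φ.exact_t_pow 6).1)))
        (φ.anti (by norm_num) hbs))
    rw [map_add, map_mul, map_mul]
    exact add_mem (smul_mem _ ha4) (smul_mem _ hb4)
  refine ⟨c, hcE, fun x hx => ?_⟩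
  obtain ⟨k, l, m, h, hh, rfl⟩ := mem_adjoin.1 hx
  have h1 : c ∈ φ.canonicalIdeal := add_mem t_cube_mem_canonicalIdeal (hR _)
  have h2 : c * φ.t ∈ φ.canonicalIdeal := by
    refine mem_of_sub (hF7 ?_) (hR (a + -s * b))
    have := sub_mem (add_mem (add_mem hap (smul_mem (-s) hbs))
      (h7 (φ.coe_mem_F_zero (s * p - β * s))))
      (h70 ht (add_mem (smul_mem (-s) hap) (smul_mem β hbs)))
    convert this using 1
    simp only [hc, hβ, map_add, map_mul, map_neg, map_sub, ha, hb]
    ring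
  have h3 : c * φ.t ^ 2 ∈ φ.canonicalIdeal := by
    refine mem_of_sub (hF7 ?_) (hR b)
    have := sub_mem (add_mem hbs (h7 (add_mem (smul_mem (s * p - β * s) ht)
      (φ.coe_mem_F_zero β)))) (h70 ht2 (add_mem (smul_mem (-s) hap) (smul_mem β hbs)))
    convert this using 1
    simp only [hc, hβ, map_add, map_mul, map_neg, map_sub, ha, hb]
    ring
  have := add_mem (add_mem (add_mem (smul_mem k h1) (smul_mem l h2)) (smul_mem m h3))
    (hF7 (mul_mem 7 hcE.1 hh (by norm_num)))
  convert this using 1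
  ring

/-- The units 1 - a t and 1 - a t² remove the t³ term from t² + a t³ and t + a t³ respectively, up
to F 4. -/
theorem exists_mul_mem_hyperplane (φ : ValueFiltration R K)
    {x : IdealClassLabel (IsLocalRing.ResidueField R ⊕ IsLocalRing.ResidueField R)}
    (hx : x ≠ .canonical) : ∃ w, φ.Exact 0 w ∧ ∀ z ∈ φ.rep x, w * z ∈ φ.rep .hyperplane := by
  have h1 := one_mem_adjoin (φ := φ) φ.t (φ.t ^ 2)
  have h2 := left_mem_adjoin (φ := φ) φ.t (φ.t ^ 2)
  have h3 := right_mem_adjoin (φ := φ) φ.t (φ.t ^ 2)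
  have h4 := F4_le_adjoin (φ := φ) φ.t (φ.t ^ 2)
  match x, hx with
  | .hyperplane, _ => exact ⟨1, exact_one, fun z hz => by simpa using hz⟩
  | .middle (.inl a), _ =>
    have hw : φ.Exact 0 (1 + algebraMap R K (-lift a) * φ.t) :=
      exact_one.add (smul_mem _ exact_t.1)
    refine ⟨_, hw, mul_mem_of_adjoin hw.1 h4 (add_mem h1 (smul_mem _ h2))
      (by simp [FractionalIdeal.zero_mem]) (mem_of_sub (h4 ?_) h3)⟩
    convert t_pow_four_mul_mem (φ.coe_mem_F_zero (-(lift a * lift a))) using 1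
    simp only [quad, map_neg, map_mul]
    ring
  | .middle (.inr a), _ =>
    have hw : φ.Exact 0 (1 + algebraMap R K (-lift a) * φ.t ^ 2) :=
      exact_one.add (smul_mem _ (φ.anti (by norm_num) exact_t_sq.1))
    refine ⟨_, hw, mul_mem_of_adjoin hw.1 h4 (add_mem h1 (smul_mem _ h3))
      (mem_of_sub (h4 ?_) h2) (by simp [FractionalIdeal.zero_mem])⟩
    convert t_pow_four_mul_mem (φ := φ) (smul_mem (-(lift a * lift a)) t_mem_zero) using 1
    simp only [lin, map_neg, map_mul]
    ring
  | .least, _ =>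
    exact ⟨1, exact_one, mul_mem_of_adjoin exact_one.1 h4 h1
      (by simp [FractionalIdeal.zero_mem]) (by simp [FractionalIdeal.zero_mem])⟩

/-- Distinct parameters give inequivalent modules. As w is a unit r plus an element of F 2,
comparing w (t² + b t³) with r (t² + a t³) leaves r (b - a) t³ modulo F 4, and the module has no
value 3. -/
theorem eq_of_mul_quad_mem {a b : IsLocalRing.ResidueField R} {w : K} (hw : φ.Exact 0 w)
    (h1 : w ∈ φ.adjoin 0 (φ.quad (lift a)))
    (h2 : w * φ.quad (lift b) ∈ φ.adjoin 0 (φ.quad (lift a))) : a = b := by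
  obtain ⟨r, l, s, f, hf, rfl⟩ := mem_adjoin.1 h1
  rw [mul_zero, add_zero] at hw h2
  have hr : φ.Exact 0 (algebraMap R K r) := by
    have := hw.add (neg_mem (add_mem (smul_mem s (φ.anti (by norm_num) (exact_quad (lift a)).1))
      (φ.anti (by norm_num) hf)))
    convert this using 1
    ring
  have h3 := sub_mem h2 (smul_mem r (right_mem_adjoin _ _))
  have hsf : (algebraMap R K s * φ.quad (lift a) + f) * φ.quad (lift b) ∈ φ.F 4 :=
    mul_mem 4 (add_mem (smul_mem s (exact_quad _).1) (φ.anti (by norm_num) hf)) (exact_quad _).1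
      (by norm_num)
  have e : (algebraMap R K r + algebraMap R K s * φ.quad (lift a) + f) * φ.quad (lift b) -
      algebraMap R K r * φ.quad (lift a) =
      algebraMap R K r * ((algebraMap R K (lift b) - algebraMap R K (lift a)) * φ.t ^ 3) +
        (algebraMap R K s * φ.quad (lift a) + f) * φ.quad (lift b) := by
    simp only [quad]
    ring
  rw [e] at h3
  have h5 : (algebraMap R K (lift b) - algebraMap R K (lift a)) * φ.t ^ 3 ∈ φ.F 3 :=
    mul_mem 3 (sub_mem (φ.coe_mem_F_zero _) (φ.coe_mem_F_zero _)) exact_t_cube.1 (by norm_num)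
  have h4 := (isNormal_adjoin (Or.inl rfl) (Or.inr (exact_quad _))).mem_four _ h3
    (add_mem (smul_mem r h5) (φ.anti (by norm_num) hsf))
  replace h4 := sub_mem h4 hsf
  rw [add_sub_cancel_right, hr.mul_mem_iff 4 4 (by norm_num), mul_comm,
    exact_t_cube.mul_mem_iff 1 4 (by norm_num)] at h4
  exact (φ.lift_inj h4).symm

/-- The comparison now leaves an extra term, s times an element of value 2. The module has no value
2, so s is a nonunit and that term falls into F 4. -/
theorem eq_of_mul_lin_mem {a b : IsLocalRing.ResidueField R} {w : K} (hw : φ.Exact 0 w)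
    (h1 : w ∈ φ.adjoin (φ.lin (lift a)) 0)
    (h2 : w * φ.lin (lift b) ∈ φ.adjoin (φ.lin (lift a)) 0) : a = b := by
  obtain ⟨r, s, l, f, hf, rfl⟩ := mem_adjoin.1 h1
  rw [mul_zero, add_zero] at hw h2
  have hr : φ.Exact 0 (algebraMap R K r) := by
    have := hw.add (neg_mem (add_mem (smul_mem s (exact_lin (lift a)).1)
      (φ.anti (by norm_num) hf)))
    convert this using 1
    ring
  have h3 := sub_mem h2 (smul_mem r (left_mem_adjoin _ _))
  have hab := (exact_lin (φ := φ) (lift a)).mul 2 (exact_lin (lift b)) (by norm_num)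
  have hff : f * φ.lin (lift b) ∈ φ.F 4 := mul_mem 4 hf (exact_lin _).1 (by norm_num)
  have h5 : algebraMap R K r * ((algebraMap R K (lift b) - algebraMap R K (lift a)) * φ.t ^ 3) ∈
      φ.F 3 :=
    smul_mem r (mul_mem 3 (sub_mem (φ.coe_mem_F_zero _) (φ.coe_mem_F_zero _)) exact_t_cube.1
      (by norm_num))
  have e : (algebraMap R K r + algebraMap R K s * φ.lin (lift a) + f) * φ.lin (lift b) -
      algebraMap R K r * φ.lin (lift a) =
      algebraMap R K r * ((algebraMap R K (lift b) - algebraMap R K (lift a)) * φ.t ^ 3) +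
        algebraMap R K s * (φ.lin (lift a) * φ.lin (lift b)) + f * φ.lin (lift b) := by
    simp only [lin]
    ring
  rw [e] at h3
  obtain ⟨c, h4⟩ := (adjoin_mem (Or.inr (exact_lin _)) (Or.inl rfl)).2 _ h3
    (add_mem (add_mem (φ.anti (by norm_num) h5) (smul_mem s hab.1)) (φ.anti (by norm_num) hff))
  rw [mul_zero, sub_zero] at h4
  replace h4 := sub_mem h4 hff
  rw [add_sub_cancel_right] at h4
  have hs : algebraMap R K s * (φ.lin (lift a) * φ.lin (lift b)) ∈ φ.F 4 := by
    refine coe_mul_mem_four (by norm_num) hab ?_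
    norm_num
    simpa using sub_mem (φ.anti (by norm_num) h4) h5
  replace h4 := sub_mem h4 hs
  rw [add_sub_cancel_right, hr.mul_mem_iff 4 4 (by norm_num), mul_comm,
    exact_t_cube.mul_mem_iff 1 4 (by norm_num)] at h4
  exact (φ.lift_inj h4).symm

/-- A multiplier of value 0 preserves the values 1 and 2, which rules out all unwanted pairs except
two middle classes of the same type. -/
theorem gen_of_mul_mem
    {x y : IdealClassLabel (IsLocalRing.ResidueField R ⊕ IsLocalRing.ResidueField R)}
    (hx : x ≠ .canonical) {w : K} (hw : φ.Exact 0 w) (h : ∀ z ∈ φ.rep x, w * z ∈ φ.rep y) :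
    IdealClassLabel.Gen y x := by
  have hw1 : ∀ z, φ.Exact 1 z → φ.Exact 1 (w * z) := fun z hz => hw.mul 1 hz (by norm_num)
  have hw2 : ∀ z, φ.Exact 2 z → φ.Exact 2 (w * z) := fun z hz => hw.mul 2 hz (by norm_num)
  match y, x, hx with
  | .canonical, _, _ => trivial
  | .hyperplane, .hyperplane, _ => trivial
  | .hyperplane, .middle _, _ => trivial
  | .hyperplane, .least, _ => trivial
  | .middle _, .least, _ => trivial
  | .least, .least, _ => trivial
  | .middle (.inl a), .hyperplane, _ =>
    exact (not_exact_one_of_adjoin (Or.inr (exact_quad _)) (h _ (left_mem_adjoin _ _))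
      (hw1 _ exact_t)).elim
  | .middle (.inr a), .hyperplane, _ =>
    exact (not_exact_two_of_adjoin (Or.inr (exact_lin _)) (h _ (right_mem_adjoin _ _))
      (hw2 _ exact_t_sq)).elim
  | .middle (.inl a), .middle (.inl b), _ =>
    have h1 := h 1 (one_mem_adjoin _ _)
    rw [mul_one] at h1
    exact congrArg Sum.inl (eq_of_mul_quad_mem hw h1 (h _ (right_mem_adjoin _ _)))
  | .middle (.inl a), .middle (.inr b), _ =>
    exact (not_exact_one_of_adjoin (Or.inr (exact_quad _)) (h _ (left_mem_adjoin _ _))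
      (hw1 _ (exact_lin _))).elim
  | .middle (.inr a), .middle (.inl b), _ =>
    exact (not_exact_two_of_adjoin (Or.inr (exact_lin _)) (h _ (right_mem_adjoin _ _))
      (hw2 _ (exact_quad _))).elim
  | .middle (.inr a), .middle (.inr b), _ =>
    have h1 := h 1 (one_mem_adjoin _ _)
    rw [mul_one] at h1
    exact congrArg Sum.inr (eq_of_mul_lin_mem hw h1 (h _ (left_mem_adjoin _ _)))
  | .least, .hyperplane, _ =>
    exact (not_exact_one_of_adjoin (Or.inl rfl) (h _ (left_mem_adjoin _ _))
      (hw1 _ exact_t)).elim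
  | .least, .middle (.inl a), _ =>
    exact (not_exact_two_of_adjoin (Or.inl rfl) (h _ (right_mem_adjoin _ _))
      (hw2 _ (exact_quad _))).elim
  | .least, .middle (.inr a), _ =>
    exact (not_exact_one_of_adjoin (Or.inl rfl) (h _ (left_mem_adjoin _ _))
      (hw1 _ (exact_lin _))).elim

theorem exists_mul_mem_of_gen
    {x y : IdealClassLabel (IsLocalRing.ResidueField R ⊕ IsLocalRing.ResidueField R)}
    (hx : x ≠ .canonical) (hy : y ≠ .canonical) (h : IdealClassLabel.Gen y x) :
    ∃ w, φ.Exact 0 w ∧ ∀ z ∈ φ.rep x, w * z ∈ φ.rep y := by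
  have hself : ∀ x, ∃ w, φ.Exact 0 w ∧ ∀ z ∈ φ.rep x, w * z ∈ φ.rep x := fun x =>
    ⟨1, exact_one, fun z hz => by simpa using hz⟩
  match y, x, h with
  | .hyperplane, _, _ => exact φ.exists_mul_mem_hyperplane hx
  | .middle a, .middle _, rfl => exact hself _
  | .least, .least, _ => exact hself _
  | .middle a, .least, _ =>
    have hn := isNormal_rep (φ := φ) hy
    exact ⟨1, exact_one, mul_mem_of_adjoin exact_one.1 hn.F4_le hn.one_mem
      (by simp [FractionalIdeal.zero_mem]) (by simp [FractionalIdeal.zero_mem])⟩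

theorem divClosure_rep_ne (φ : ValueFiltration R K)
    (x : IdealClassLabel (IsLocalRing.ResidueField R ⊕ IsLocalRing.ResidueField R)) :
    divClosure (φ.rep x) ≠ φ.rep x := by
  by_cases hx : x = .canonical
  · subst hx
    exact divClosure_canonicalIdeal_ne
  · exact (isNormal_rep hx).divClosure_ne

theorem rep_eq_or_eq (φ : ValueFiltration R K)
    (x : IdealClassLabel (IsLocalRing.ResidueField R ⊕ IsLocalRing.ResidueField R))
    (J : FractionalIdeal R⁰ K) (h : φ.rep x ≤ J) (h' : J ≤ divClosure (φ.rep x)) :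
    J = φ.rep x ∨ J = divClosure (φ.rep x) := by
  by_cases hx : x = .canonical
  · subst hx
    exact canonicalIdeal_eq_or_eq J h h'
  · exact (isNormal_rep hx).eq_or_eq J h h'

/-- Between normal modules the multiplier has value 0. Into C one of value 3 is used. No multiple of
a normal module separates C from its closure. -/
theorem exists_iff_gen (φ : ValueFiltration R K)
    (x y : IdealClassLabel (IsLocalRing.ResidueField R ⊕ IsLocalRing.ResidueField R)) :
    (∃ c : K, c ≠ 0 ∧ φ.rep x ≤ spanSingleton R⁰ c * φ.rep y ∧
      ¬ divClosure (φ.rep x) ≤ spanSingleton R⁰ c * φ.rep y) ↔ IdealClassLabel.Gen y x := by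
  by_cases hx : x = .canonical <;> by_cases hy : y = .canonical
  · subst hx hy
    refine ⟨fun _ => trivial, fun _ => ⟨1, one_ne_zero, by simp, fun h => ?_⟩⟩
    exact φ.divClosure_rep_ne .canonical (le_antisymm (by simpa using h) (le_divClosure _))
  · subst hx
    refine ⟨fun ⟨c, hc, hle, hnle⟩ => ?_, fun h => ?_⟩
    · exact absurd ((isNormal_rep hy).divClosure_canonicalIdeal_le hc hle) hnle
    · cases y <;> simp_all [IdealClassLabel.Gen]
  · subst hy
    refine ⟨fun _ => trivial, fun _ => ?_⟩
    obtain ⟨c, hc, hcW⟩ := φ.exists_mul_hyperplane_mem_canonical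
    obtain ⟨w, hw, hwx⟩ := φ.exists_mul_mem_hyperplane hx
    have hcw := hc.mul 3 hw (by norm_num)
    refine ⟨(c * w)⁻¹, inv_ne_zero hcw.ne_zero, fun z hz => ?_, fun hle => ?_⟩
    · rw [mem_spanSingleton_mul_iff (inv_ne_zero hcw.ne_zero), inv_inv, mul_assoc]
      exact hcW _ (hwx z hz)
    · have := hle ((isNormal_rep hx).F3_le_divClosure exact_t_cube.1)
      rw [mem_spanSingleton_mul_iff (inv_ne_zero hcw.ne_zero), inv_inv] at this
      have h6 := hcw.mul 6 exact_t_cube (by norm_num)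
      exact h6.2 (canonicalIdeal_mem_seven this h6.1)
  · refine ⟨fun ⟨c, hc, hle, hnle⟩ => ?_, fun h => ?_⟩
    · have hcE := (isNormal_rep hx).exact_zero (isNormal_rep hy) hc hle hnle
      exact gen_of_mul_mem hx (hcE.inv 0 (by norm_num)) fun z hz =>
        (mem_spanSingleton_mul_iff hc).1 (hle hz)
    · obtain ⟨w, hw, hwx⟩ := exists_mul_mem_of_gen (φ := φ) hx hy h
      exact (isNormal_rep hx).exists_of_exact_zero (isNormal_rep hy) hw hwx

theorem card_starOperation (φ : ValueFiltration R K) [Finite (IsLocalRing.ResidueField R)] :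
    Finite (StarOperation R K) ∧
      Nat.card (StarOperation R K) = 2 ^ (2 * Nat.card (IsLocalRing.ResidueField R)) + 3 := by
  obtain ⟨f, hf⟩ := bijective_closedSets φ.rep IdealClassLabel.Gen φ.divClosure_eq_or_exists
    φ.divClosure_rep_ne φ.rep_eq_or_eq φ.exists_iff_gen
  obtain ⟨hfin, hcard⟩ := IdealClassLabel.card_closedSets
    (Y := IsLocalRing.ResidueField R ⊕ IsLocalRing.ResidueField R)
  refine ⟨Finite.of_injective f hf.1, ?_⟩
  rw [Nat.card_eq_of_bijective f hf, hcard, Nat.card_sum, two_mul]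

end ValueFiltration

/-! ### The semigroup ⟨4, 5, 7⟩. -/

theorem mem_closure_four_five_seven (n : ℕ) :
    n ∈ AddSubmonoid.closure ({4, 5, 7} : Set ℕ) ↔ n = 0 ∨ n = 4 ∨ n = 5 ∨ 7 ≤ n := by
  constructor
  · intro h
    induction h using AddSubmonoid.closure_induction with
    | mem x hx =>
      simp only [Set.mem_insert_iff, Set.mem_singleton_iff] at hx
      omega
    | zero => simp
    | add x y _ _ hx hy => omega
  · have h4 : 4 ∈ AddSubmonoid.closure ({4, 5, 7} : Set ℕ) :=
      AddSubmonoid.subset_closure (by simp)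
    have h5 : 5 ∈ AddSubmonoid.closure ({4, 5, 7} : Set ℕ) :=
      AddSubmonoid.subset_closure (by simp)
    have h7 : 7 ∈ AddSubmonoid.closure ({4, 5, 7} : Set ℕ) :=
      AddSubmonoid.subset_closure (by simp)
    rintro (rfl | rfl | rfl | h)
    · exact zero_mem _
    · exact h4
    · exact h5
    · induction n using Nat.strong_induction_on with
      | _ n ih =>
        -- 7, 8, 9, 10 are sums of generators, and adding 4 repeatedly reaches the rest.
        by_cases h11 : n < 11
        · obtain rfl | rfl | rfl | rfl : n = 7 ∨ n = 4 + 4 ∨ n = 4 + 5 ∨ n = 5 + 5 := by omega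
          exacts [h7, add_mem h4 h4, add_mem h4 h5, add_mem h5 h5]
        · obtain ⟨m, rfl⟩ : ∃ m, n = m + 4 := ⟨n - 4, by omega⟩
          exact add_mem (ih m (by omega) (by omega)) h4

/-! ### Construction of the filtration from the discrete valuation ring. -/

section DVR

open IsDiscreteValuationRing

variable {R V K : Type*} [CommRing R] [CommRing V] [IsDomain V] [IsDiscreteValuationRing V]
  [Field K] [Algebra R V] [Algebra R K] [Algebra V K] [IsScalarTower R V K]

/-- The `R`-module `ϖ ^ n V`. -/
def valuationSubmodule (R : Type*) {V : Type*} (K : Type*) [CommRing R] [CommRing V] [Field K]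
    [Algebra R V] [Algebra R K] [Algebra V K] [IsScalarTower R V K] (ϖ : V) (n : ℤ) :
    Submodule R K where
  carrier := {x | ∃ v : V, x = algebraMap V K ϖ ^ n * algebraMap V K v}
  zero_mem' := ⟨0, by simp⟩
  add_mem' := by
    rintro _ _ ⟨v, rfl⟩ ⟨w, rfl⟩
    exact ⟨v + w, by rw [map_add, mul_add]⟩
  smul_mem' := by
    rintro r _ ⟨v, rfl⟩
    exact ⟨algebraMap R V r * v, by
      rw [map_mul, ← IsScalarTower.algebraMap_apply, Algebra.smul_def, mul_left_comm]⟩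

theorem mem_valuationSubmodule {ϖ : V} {n : ℤ} {x : K} : x ∈ valuationSubmodule R K ϖ n ↔
    ∃ v : V, x = algebraMap V K ϖ ^ n * algebraMap V K v := Iff.rfl

variable [IsFractionRing V K] {ϖ : V}

theorem algebraMap_irreducible_ne_zero (hϖ : Irreducible ϖ) : algebraMap V K ϖ ≠ 0 := by
  simpa using hϖ.ne_zero

theorem valuationSubmodule_anti (hϖ : Irreducible ϖ) {m n : ℤ} (h : m ≤ n) :
    valuationSubmodule R K ϖ n ≤ valuationSubmodule R K ϖ m := by
  rintro _ ⟨v, rfl⟩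
  obtain ⟨k, rfl⟩ := Int.le.dest h
  refine ⟨ϖ ^ k * v, ?_⟩
  rw [zpow_add₀ (algebraMap_irreducible_ne_zero hϖ), map_mul, map_pow, zpow_natCast, mul_assoc]

theorem exists_eq_zpow_mul (hϖ : Irreducible ϖ) {x : K} (hx : x ≠ 0) :
    ∃ (n : ℤ) (u : Vˣ), x = algebraMap V K ϖ ^ n * algebraMap V K u := by
  obtain ⟨n, u, h⟩ := exists_units_eq_smul_zpow_of_irreducible (K := K) hϖ hx
  exact ⟨n, u, by rw [h, Units.smul_def, Algebra.smul_def, mul_comm]⟩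

theorem zpow_mul_mem_iff (hϖ : Irreducible ϖ) {m n : ℤ} (u : Vˣ) :
    algebraMap V K ϖ ^ n * algebraMap V K u ∈ valuationSubmodule R K ϖ m ↔ m ≤ n := by
  have hne := algebraMap_irreducible_ne_zero (K := K) hϖ
  constructor
  · rintro ⟨v, hv⟩
    by_contra h
    obtain ⟨k, hk⟩ := Int.le.dest (show n + 1 ≤ m by omega)
    rw [← hk, show n + 1 + (k : ℤ) = n + ((k + 1 : ℕ) : ℤ) by push_cast; ring, zpow_add₀ hne,
      mul_assoc, mul_right_inj' (zpow_ne_zero _ hne), zpow_natCast, ← map_pow, ← map_mul] at hv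
    have := IsFractionRing.injective V K hv
    exact hϖ.not_isUnit (isUnit_of_dvd_unit ⟨ϖ ^ k * v, by rw [this]; ring⟩ u.isUnit)
  · intro h
    exact valuationSubmodule_anti hϖ h ⟨u, rfl⟩

theorem eq_zpow_of_exact (hϖ : Irreducible ϖ) {n : ℤ} {x : K}
    (hx : x ∈ valuationSubmodule R K ϖ n) (hx' : x ∉ valuationSubmodule R K ϖ (n + 1)) :
    ∃ u : Vˣ, x = algebraMap V K ϖ ^ n * algebraMap V K u := by
  have hx0 : x ≠ 0 := by
    rintro rfl
    exact hx' (zero_mem _)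
  obtain ⟨m, u, rfl⟩ := exists_eq_zpow_mul hϖ hx0
  rw [zpow_mul_mem_iff hϖ] at hx hx'
  obtain rfl : n = m := by omega
  exact ⟨u, rfl⟩

theorem mul_notMem_valuationSubmodule (hϖ : Irreducible ϖ) {m n : ℤ} {x y : K}
    (hx : x ∉ valuationSubmodule R K ϖ (m + 1)) (hy : y ∉ valuationSubmodule R K ϖ (n + 1)) :
    x * y ∉ valuationSubmodule R K ϖ (m + n + 1) := by
  have hx0 : x ≠ 0 := by
    rintro rfl
    exact hx (zero_mem _)
  have hy0 : y ≠ 0 := by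
    rintro rfl
    exact hy (zero_mem _)
  obtain ⟨a, u, rfl⟩ := exists_eq_zpow_mul hϖ hx0
  obtain ⟨b, v, rfl⟩ := exists_eq_zpow_mul hϖ hy0
  rw [zpow_mul_mem_iff hϖ] at hx hy
  rw [mul_mul_mul_comm, ← zpow_add₀ (algebraMap_irreducible_ne_zero hϖ), ← map_mul,
    ← Units.val_mul, zpow_mul_mem_iff hϖ]
  omega

theorem exists_of_mem_valueSemigroup (hϖ : Irreducible ϖ) {n : ℕ} (hn : n ∈ valueSemigroup R V) :
    ∃ (r : R) (u : Vˣ), algebraMap R K r = algebraMap V K ϖ ^ (n : ℤ) * algebraMap V K u := by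
  obtain ⟨r, hr⟩ := hn
  have hr0 : algebraMap R V r ≠ 0 := by
    intro h
    rw [h, addVal_zero] at hr
    exact ENat.top_ne_natCast _ hr
  obtain ⟨m, u, hu⟩ := eq_unit_mul_pow_irreducible hr0 hϖ
  rw [hu, addVal_def' u hϖ m, Nat.cast_inj] at hr
  subst hr
  exact ⟨r, u, by rw [IsScalarTower.algebraMap_apply R V K, hu, map_mul, map_pow, zpow_natCast,
    mul_comm]⟩

theorem exists_mem_valueSemigroup (hϖ : Irreducible ϖ) {r : R} (hr : algebraMap R K r ≠ 0) :
    ∃ n ∈ valueSemigroup R V, ∀ m : ℤ,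
      algebraMap R K r ∈ valuationSubmodule R K ϖ m ↔ m ≤ n := by
  have hr0 : algebraMap R V r ≠ 0 := by
    intro h
    rw [IsScalarTower.algebraMap_apply R V K, h, map_zero] at hr
    exact hr rfl
  obtain ⟨n, u, hu⟩ := eq_unit_mul_pow_irreducible hr0 hϖ
  refine ⟨n, ⟨r, by rw [hu, addVal_def' u hϖ n]⟩, fun m => ?_⟩
  rw [← zpow_mul_mem_iff (R := R) (K := K) hϖ u, IsScalarTower.algebraMap_apply R V K, hu, map_mul,
    map_pow, zpow_natCast, mul_comm]

variable [IsLocalRing R] [IsLocalHom (algebraMap R V)]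

theorem valuationSubmodule_approx (hϖ : Irreducible ϖ)
    (hres : Function.Surjective (IsLocalRing.ResidueField.map (algebraMap R V))) {n : ℤ} {x y : K}
    (hx : x ∈ valuationSubmodule R K ϖ n) (hx' : x ∉ valuationSubmodule R K ϖ (n + 1))
    (hy : y ∈ valuationSubmodule R K ϖ n) :
    ∃ r : R, y - algebraMap R K r * x ∈ valuationSubmodule R K ϖ (n + 1) := by
  obtain ⟨u, rfl⟩ := eq_zpow_of_exact hϖ hx hx'
  obtain ⟨v, rfl⟩ := hy
  obtain ⟨a, ha⟩ := hres (IsLocalRing.residue V (v * (u⁻¹ : Vˣ)))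
  obtain ⟨r, rfl⟩ := IsLocalRing.residue_surjective a
  rw [IsLocalRing.ResidueField.map_residue] at ha
  have h1 : v - algebraMap R V r * u ∈ IsLocalRing.maximalIdeal V := by
    rw [← IsLocalRing.residue_eq_zero_iff, map_sub, map_mul, ha, ← map_mul, mul_assoc,
      Units.inv_mul, mul_one, sub_self]
  rw [hϖ.maximalIdeal_eq, Ideal.mem_span_singleton] at h1
  obtain ⟨w, hw⟩ := h1
  refine ⟨r, w, ?_⟩
  rw [zpow_add_one₀ (algebraMap_irreducible_ne_zero hϖ), mul_assoc, ← map_mul, ← hw, map_sub,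
    map_mul, ← IsScalarTower.algebraMap_apply]
  ring

theorem exists_valuationSubmodule_le (hϖ : Irreducible ϖ)
    (hcond : ∃ x : K, x ≠ 0 ∧ ∀ v : V, ∃ r : R, algebraMap R K r = x * algebraMap V K v) :
    ∃ N : ℕ, ∀ y ∈ valuationSubmodule R K ϖ N, ∃ r : R, algebraMap R K r = y := by
  obtain ⟨x, hx, h⟩ := hcond
  obtain ⟨n, u, rfl⟩ := exists_eq_zpow_mul hϖ hx
  refine ⟨n.toNat, fun y hy => ?_⟩
  obtain ⟨v, rfl⟩ := valuationSubmodule_anti hϖ (Int.self_le_toNat n) hy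
  obtain ⟨r, hr⟩ := h ((u⁻¹ : Vˣ) * v)
  refine ⟨r, ?_⟩
  rw [hr, map_mul, mul_assoc, ← mul_assoc (algebraMap V K u), ← map_mul, Units.mul_inv, map_one,
    one_mul]

/-- The conductor puts some ϖ^N V inside R. Since every value from 7 on occurs in R and residues
lift to R, this descends one value at a time to ϖ⁷ V. -/
theorem valuationSubmodule_seven_le (hϖ : Irreducible ϖ)
    (hres : Function.Surjective (IsLocalRing.ResidueField.map (algebraMap R V)))
    (hcond : ∃ x : K, x ≠ 0 ∧ ∀ v : V, ∃ r : R, algebraMap R K r = x * algebraMap V K v)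
    (hS : valueSemigroup R V = AddSubmonoid.closure {4, 5, 7}) :
    ∀ y ∈ valuationSubmodule R K ϖ 7, ∃ r : R, algebraMap R K r = y := by
  obtain ⟨N, hN⟩ := exists_valuationSubmodule_le (R := R) hϖ hcond
  have step : ∀ k : ℕ, (∀ y ∈ valuationSubmodule R K ϖ (7 + (k : ℤ)), ∃ r : R,
      algebraMap R K r = y) → ∀ y ∈ valuationSubmodule R K ϖ 7, ∃ r : R, algebraMap R K r = y := by
    intro k
    induction k with
    | zero => simp
    | succ k ih =>
      refine fun h => ih fun y hy => ?_
      have hk : 7 + k ∈ valueSemigroup R V := by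
        rw [hS, mem_closure_four_five_seven]
        omega
      obtain ⟨r, u, hr⟩ := exists_of_mem_valueSemigroup (K := K) hϖ hk
      push_cast at hr
      obtain ⟨s, hs⟩ := valuationSubmodule_approx hϖ hres
        (hr ▸ (zpow_mul_mem_iff (R := R) hϖ u).2 le_rfl)
        (hr ▸ fun h' => absurd ((zpow_mul_mem_iff (R := R) hϖ u).1 h') (by omega)) hy
      obtain ⟨a, ha⟩ := h _ (by push_cast; rwa [← add_assoc])
      exact ⟨a + s * r, by rw [map_add, map_mul, ha]; ring⟩
  exact step N fun y hy => hN y (valuationSubmodule_anti hϖ (by omega) hy)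

theorem isFractional_valuationSubmodule [IsDomain R] [IsFractionRing R K] (hϖ : Irreducible ϖ)
    (h7 : ∀ y ∈ valuationSubmodule R K ϖ 7, ∃ r : R, algebraMap R K r = y) (n : ℤ) :
    IsFractional R⁰ (valuationSubmodule R K ϖ n) := by
  have hne := algebraMap_irreducible_ne_zero (K := K) hϖ
  -- Exponent at least 7 puts the denominator in R; at least 7 - n makes it carry ϖ^n V into ϖ⁷ V ⊆
  -- R.
  obtain ⟨d, hd⟩ := h7 (algebraMap V K ϖ ^ (max 7 (7 - n)))
    (valuationSubmodule_anti hϖ (le_max_left 7 (7 - n)) ⟨1, by simp⟩)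
  refine ⟨d, mem_nonZeroDivisors_of_ne_zero ?_, ?_⟩
  · rintro rfl
    rw [map_zero] at hd
    exact zpow_ne_zero _ hne hd.symm
  · rintro _ ⟨v, rfl⟩
    refine h7 _ (valuationSubmodule_anti hϖ (show 7 ≤ max 7 (7 - n) + n by
      have := le_max_right 7 (7 - n)
      omega) ⟨v, ?_⟩)
    rw [Algebra.smul_def, hd, zpow_add₀ hne, mul_assoc]

/-- The filtration attached to a Kunz domain with value semigroup `⟨4, 5, 7⟩`. -/
theorem nonempty_valueFiltration [IsDomain R] [IsFractionRing R K]
    (hres : Function.Surjective (IsLocalRing.ResidueField.map (algebraMap R V)))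
    (hcond : ∃ x : K, x ≠ 0 ∧ ∀ v : V, ∃ r : R, algebraMap R K r = x * algebraMap V K v)
    (hS : valueSemigroup R V = AddSubmonoid.closure {4, 5, 7}) :
    Nonempty (ValueFiltration R K) := by
  obtain ⟨ϖ, hϖ⟩ := exists_irreducible V
  have hne := algebraMap_irreducible_ne_zero (K := K) hϖ
  have h7 := valuationSubmodule_seven_le (R := R) (K := K) hϖ hres hcond hS
  have hval : ∀ r : R, algebraMap R K r ≠ 0 → ∃ n : ℕ, (n = 0 ∨ n = 4 ∨ n = 5 ∨ 7 ≤ n) ∧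
      ∀ m : ℤ, algebraMap R K r ∈ valuationSubmodule R K ϖ m ↔ m ≤ n := by
    intro r hr
    obtain ⟨n, hn, h⟩ := exists_mem_valueSemigroup (V := V) hϖ hr
    rw [hS, mem_closure_four_five_seven] at hn
    exact ⟨n, hn, h⟩
  obtain ⟨x₄, u₄, h₄⟩ := exists_of_mem_valueSemigroup (R := R) (V := V) (K := K) (n := 4) hϖ (by
    rw [hS, mem_closure_four_five_seven]
    omega)
  obtain ⟨x₅, u₅, h₅⟩ := exists_of_mem_valueSemigroup (R := R) (V := V) (K := K) (n := 5) hϖ (by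
    rw [hS, mem_closure_four_five_seven]
    omega)
  have ht : algebraMap V K ϖ = algebraMap V K ϖ ^ (1 : ℤ) * algebraMap V K (1 : Vˣ) := by simp
  have h1 : (1 : K) = algebraMap V K ϖ ^ (0 : ℤ) * algebraMap V K (1 : Vˣ) := by simp
  refine ⟨{
    F := fun n => ⟨valuationSubmodule R K ϖ n, isFractional_valuationSubmodule hϖ h7 n⟩
    anti := fun h => valuationSubmodule_anti hϖ h
    mul_mem_add := ?_
    mul_notMem := fun hx hy => mul_notMem_valuationSubmodule hϖ hx hy
    exists_exact := ?_
    approx := fun hx hx' hy => valuationSubmodule_approx hϖ hres hx hx' hy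
    t := algebraMap V K ϖ
    t_mem := ?_
    t_notMem := ?_
    one_notMem := ?_
    one_le := ?_
    F7_le := fun x hx => (mem_one_iff _).2 (h7 x hx)
    mem_four := ?_
    mem_seven := ?_
    x₄ := x₄
    x₄_mem := ?_
    x₄_notMem := ?_
    x₅ := x₅
    x₅_mem := ?_
    x₅_notMem := ?_
    mem_maximal := ?_ }⟩
  · rintro m n _ _ ⟨v, rfl⟩ ⟨w, rfl⟩
    exact ⟨v * w, by rw [zpow_add₀ hne, map_mul, mul_mul_mul_comm]⟩
  · intro x hx
    obtain ⟨n, u, rfl⟩ := exists_eq_zpow_mul hϖ hx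
    exact ⟨n, (zpow_mul_mem_iff hϖ u).2 le_rfl, fun h => by
      have := (zpow_mul_mem_iff hϖ u).1 h
      omega⟩
  · exact ⟨1, by simp⟩
  · intro h
    have h' : algebraMap V K ϖ ∈ valuationSubmodule R K ϖ 2 := h
    rw [ht] at h'
    have := (zpow_mul_mem_iff hϖ 1).1 h'
    omega
  · intro h
    have h' : (1 : K) ∈ valuationSubmodule R K ϖ 1 := h
    rw [h1] at h'
    have := (zpow_mul_mem_iff hϖ 1).1 h'
    omega
  · intro x hx
    obtain ⟨r, rfl⟩ := (mem_one_iff _).1 hx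
    exact ⟨algebraMap R V r, by rw [← IsScalarTower.algebraMap_apply]; simp⟩
  · intro x hx hx1
    obtain ⟨r, rfl⟩ := (mem_one_iff _).1 hx
    rcases eq_or_ne (algebraMap R K r) 0 with h0 | h0
    · rw [h0]
      exact FractionalIdeal.zero_mem _
    · obtain ⟨n, hn, h⟩ := hval r h0
      have := (h 1).1 hx1
      exact (h 4).2 (by omega)
  · intro x hx hx6
    obtain ⟨r, rfl⟩ := (mem_one_iff _).1 hx
    rcases eq_or_ne (algebraMap R K r) 0 with h0 | h0
    · rw [h0]
      exact FractionalIdeal.zero_mem _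
    · obtain ⟨n, hn, h⟩ := hval r h0
      have := (h 6).1 hx6
      exact (h 7).2 (by omega)
  · exact ⟨u₄, h₄⟩
  · intro h
    have := (zpow_mul_mem_iff (R := R) hϖ u₄).1 (h₄ ▸ h)
    omega
  · exact ⟨u₅, h₅⟩
  · intro h
    have := (zpow_mul_mem_iff (R := R) hϖ u₅).1 (h₅ ▸ h)
    omega
  · intro r
    have hmem : algebraMap R K r ∈ valuationSubmodule R K ϖ 1 ↔
        algebraMap R V r ∈ IsLocalRing.maximalIdeal V := by
      rw [hϖ.maximalIdeal_eq, Ideal.mem_span_singleton, mem_valuationSubmodule]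
      refine exists_congr fun v => ?_
      rw [IsScalarTower.algebraMap_apply R V K, zpow_one, ← map_mul,
        (IsFractionRing.injective V K).eq_iff]
    refine Iff.trans ?_ hmem.symm
    rw [IsLocalRing.mem_maximalIdeal, IsLocalRing.mem_maximalIdeal, mem_nonunits_iff,
      mem_nonunits_iff, isUnit_map_iff]

end DVR

theorem mainTheorem5 (R V K : Type*) [CommRing R] [IsDomain R] [IsLocalRing R]
    [CommRing V] [IsDomain V] [IsDiscreteValuationRing V] [Field K]
    [Algebra R V] [Algebra R K] [Algebra V K] [IsScalarTower R V K] [IsFractionRing R K]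
    (hR : IsKunzDomain R V K)
    (hS : valueSemigroup R V = AddSubmonoid.closure {4, 5, 7})
    (q : ℕ) [Finite (IsLocalRing.ResidueField R)]
    (hq : Nat.card (IsLocalRing.ResidueField R) = q) :
    Finite (StarOperation R K) ∧ Nat.card (StarOperation R K) = 2 ^ (2 * q) + 3 := by
  have := hR.isFractionRing_right
  have := hR.isLocalHom
  obtain ⟨φ⟩ := nonempty_valueFiltration hR.residueField_bijective.2 hR.conductor_ne_zero hS
  rw [← hq]
  exact φ.card_starOperation
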